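/- Let $R$ be an integral domain with quotient field $K$. For a nonzero ideal $I$ put $I^{-1}=\{x\in K \mid xI\subseteq R\}$, $I_v=(I^{-1})^{-1}$ and $I_t=\bigcup J_v$, the union being over all nonzero finitely generated ideals $J\subseteq I$. A $t$-ideal is a nonzero ideal $I$ with $I=I_t$; a $t$-prime is a prime $t$-ideal; a maximal $t$-ideal is a maximal element of the set of proper $t$-ideals; and a $v$-finite ideal is one of the form $J_v$ with $J$ a nonzero finitely generated ideal. Call $R$ a Prüfer $v$-multiplication domain (PVMD) if $R_M$ is a valuation domain for each maximal $t$-ideal $M$ of $R$. For a set $\Lambda$ of $t$-primes of $R$ let $\Phi(\Lambda)$ be the set of all $t$-ideals $I$ of $R$ with $I\not\subseteq P$ for every $P\in\Lambda$; it is called $v$-finite if each ideal in $\Phi(\Lambda)$ contains a $v$-finite ideal that is also in $\Phi(\Lambda)$. A domain $T$ is a $t\#$-domain if $\bigcap_{M\in\mathcal M_1}T_M\neq\bigcap_{M\in\mathcal M_2}T_M$ for any two distinct sets $\mathcal M_1,\mathcal M_2$ of maximal $t$-ideals of $T$ (an empty intersection being the quotient field). An overring $T$ of $R$ (a ring with $R\subseteq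 T\subseteq K$) is $t$-linked over $R$ if, for each finitely generated ideal $I$ of $R$, $(R:_K I)=R$ implies $(T:_K IT)=T$. A prime ideal $P$ is branched if there is a $P$-primary ideal different from $P$. **Proposition.** Let $R$ be a PVMD. Then the following statements are equivalent. 1. For each set $\Lambda$ of $t$-primes of $R$, $\Phi(\Lambda)$ is $v$-finite. 2. $R$ satisfies the ascending chain condition on $t$-primes, and $\Phi(\Lambda)$ is $v$-finite for each set $\Lambda$ of pairwise incomparable $t$-primes of $R$. 3. $R$ satisfies the ascending chain condition on radical $t$-ideals. 4. $R$ satisfies the ascending chain condition on $t$-primes, and, for each nonzero finitely generated ideal $I$ of $R$, the set of minimal primes of $I_v$ is finite. 5. Each $t$-prime of $R$ is branched, and each $t$-linked overring of $R$ is a $t\#$-domain. 6. $R$ satisfies the ascending chain condition on $t$-primes, and each $t$-linked overring of $R$ is a $t\#$-domain. -/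

import Mathlib

/-!
Throughout, `R` is an integral domain, `K` is its quotient field, and overrings of `R` are the
`R`-subalgebras `T` of `K`; `K` is then also the quotient field of `T`, so that all the notions
below can be applied to `T` and `K` as well.
-/

namespace TSharp

section

variable {R : Type*} [CommRing R] (K : Type*) [Field K] [Algebra R K]

/-- The inverse `(R :_K I)` of an ideal `I`, i.e. the set of all `x` in `K` with `x I ⊆ R`. -/
noncomputable def inverse (I : Ideal R) : Submodule R K :=
  1 / IsLocalization.coeSubmodule K I

/-- The ideal `I_v = (I⁻¹)⁻¹`.  (It is contained in `R` because `1` lies in `I⁻¹`.) -/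
noncomputable def vClosure (I : Ideal R) : Ideal R :=
  (1 / inverse K I).comap (Algebra.linearMap R K)

/-- `I_t` is the union of the `J_v` over all nonzero finitely generated ideals `J ⊆ I`. -/
def tClosure (I : Ideal R) : Set R :=
  ⋃ J ∈ {J : Ideal R | J ≠ ⊥ ∧ J.FG ∧ J ≤ I}, (vClosure K J : Set R)

/-- A `t`-ideal is a nonzero ideal `I` with `I_t = I`. -/
def IsTIdeal (I : Ideal R) : Prop :=
  I ≠ ⊥ ∧ tClosure K I = (I : Set R)

/-- A `t`-prime is a prime ideal that is a `t`-ideal (in particular it is nonzero). -/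
def IsTPrime (P : Ideal R) : Prop :=
  P.IsPrime ∧ IsTIdeal K P

/-- A maximal `t`-ideal is a maximal element of the set of proper `t`-ideals. -/
def IsMaximalTIdeal (M : Ideal R) : Prop :=
  Maximal (fun I : Ideal R => IsTIdeal K I ∧ I ≠ ⊤) M

variable {K}

theorem mem_inverse {I : Ideal R} {y : K} :
    y ∈ inverse K I ↔ ∀ a ∈ I, y * algebraMap R K a ∈ (1 : Submodule R K) := by
  simp [inverse, Submodule.mem_div_iff_forall_mul_mem]

theorem mem_vClosure {I : Ideal R} {r : R} :
    r ∈ vClosure K I ↔ ∀ y ∈ inverse K I, algebraMap R K r * y ∈ (1 : Submodule R K) := by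
  simp [vClosure, Submodule.mem_div_iff_forall_mul_mem]

theorem le_vClosure (I : Ideal R) : I ≤ vClosure K I := fun r hr =>
  mem_vClosure.2 fun y hy => by rw [mul_comm]; exact mem_inverse.1 hy r hr

theorem vClosure_le {I J : Ideal R} (h : I ≤ vClosure K J) : vClosure K I ≤ vClosure K J :=
  fun r hr => mem_vClosure.2 fun y hy => mem_vClosure.1 hr y <| mem_inverse.2 fun a ha => by
    rw [mul_comm]; exact mem_vClosure.1 (h ha) y hy

theorem one_mem_vClosure_mul {I J : Ideal R} (hI : 1 ∈ vClosure K I) (hJ : 1 ∈ vClosure K J) :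
    1 ∈ vClosure K (I * J) := by
  refine mem_vClosure.2 fun y hy => mem_vClosure.1 hJ y <| mem_inverse.2 fun b hb => ?_
  have := mem_vClosure.1 hI (y * algebraMap R K b) <| mem_inverse.2 fun a ha => by
    have := mem_inverse.1 hy (a * b) (Ideal.mul_mem_mul ha hb)
    rwa [map_mul, mul_comm (algebraMap R K a), ← mul_assoc] at this
  simpa using this

theorem mem_tClosure {I : Ideal R} {r : R} :
    r ∈ tClosure K I ↔ ∃ J : Ideal R, (J ≠ ⊥ ∧ J.FG ∧ J ≤ I) ∧ r ∈ vClosure K J := by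
  simp [tClosure]

theorem exists_fg_of_le_tClosure {I J : Ideal R} (hJ : J.FG)
    (h : (J : Set R) ⊆ tClosure K I) :
    ∃ L : Ideal R, (L ≠ ⊥ ∧ L.FG ∧ L ≤ I) ∧ J ≤ vClosure K L := by
  induction J, hJ using Submodule.fg_induction with
  | singleton x =>
    obtain ⟨L, hL, hx⟩ := mem_tClosure.1 (h (Submodule.mem_span_singleton_self x))
    exact ⟨L, hL, (Submodule.span_singleton_le_iff_mem _ _).2 hx⟩
  | sup A B _ _ hA hB =>
    obtain ⟨L, ⟨h0, h1, h2⟩, hL⟩ := hA fun x hx => h ((le_sup_left : A ≤ A ⊔ B) hx)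
    obtain ⟨L', ⟨h0', h1', h2'⟩, hL'⟩ := hB fun x hx => h ((le_sup_right : B ≤ A ⊔ B) hx)
    refine ⟨L ⊔ L', ⟨fun e => h0 (by simp_all), Submodule.FG.sup h1 h1', sup_le h2 h2'⟩, sup_le ?_ ?_⟩
    · exact hL.trans (vClosure_le (le_sup_left.trans (le_vClosure _)))
    · exact hL'.trans (vClosure_le (le_sup_right.trans (le_vClosure _)))

/-- If a maximal `t`-ideal is properly contained in `I`, then `I_t = R`. -/
theorem IsMaximalTIdeal.one_mem {M I : Ideal R} (hM : IsMaximalTIdeal K M) (h : M < I) :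
    1 ∈ tClosure K I := by
  have hI : I ≠ ⊥ := (bot_le.trans_lt h).ne'
  have sub : (I : Set R) ⊆ tClosure K I := fun x hx => by
    obtain ⟨m, hm, hm0⟩ := Submodule.exists_mem_ne_zero_of_ne_bot hI
    refine mem_tClosure.2 ⟨Ideal.span {x, m}, ⟨?_, ?_, ?_⟩, ?_⟩
    · intro e
      exact hm0 (Ideal.span_eq_bot.1 e m (by simp))
    · exact Submodule.fg_span (by simp)
    · rw [Ideal.span_le]; rintro z (rfl | rfl) <;> assumption
    · exact le_vClosure _ (Ideal.subset_span (by simp))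
  let A : Ideal R :=
    { carrier := tClosure K I
      zero_mem' := sub I.zero_mem
      add_mem' := by
        intro x y hx hy
        obtain ⟨L, ⟨h0, h1, h2⟩, hL⟩ := mem_tClosure.1 hx
        obtain ⟨L', ⟨h0', h1', h2'⟩, hL'⟩ := mem_tClosure.1 hy
        refine mem_tClosure.2 ⟨L ⊔ L', ⟨fun e => h0 (by simp_all), Submodule.FG.sup h1 h1', sup_le h2 h2'⟩,
          Ideal.add_mem _ ?_ ?_⟩
        · exact vClosure_le (le_sup_left.trans (le_vClosure _)) hL
        · exact vClosure_le (le_sup_right.trans (le_vClosure _)) hL'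
      smul_mem' := by
        intro c x hx
        obtain ⟨L, hL, hx⟩ := mem_tClosure.1 hx
        exact mem_tClosure.2 ⟨L, hL, Ideal.mul_mem_left _ c hx⟩ }
  have hIA : I ≤ A := sub
  have hA : IsTIdeal K A := by
    refine ⟨fun e => hI (le_bot_iff.1 (e ▸ hIA)), Set.Subset.antisymm ?_ ?_⟩
    · intro x hx
      obtain ⟨J, ⟨_, h1, h2⟩, hJ⟩ := mem_tClosure.1 hx
      obtain ⟨L, hL, hJL⟩ := exists_fg_of_le_tClosure h1 h2
      exact mem_tClosure.2 ⟨L, hL, vClosure_le hJL hJ⟩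
    · intro x hx
      obtain ⟨L, ⟨h0, h1, h2⟩, hL⟩ := mem_tClosure.1 (show x ∈ tClosure K I from hx)
      exact mem_tClosure.2 ⟨L, ⟨h0, h1, h2.trans hIA⟩, hL⟩
  by_contra h1
  have hA' : A ≠ ⊤ := fun e => h1 ((Ideal.eq_top_iff_one A).1 e)
  exact (h.trans_le hIA).not_ge (hM.2 ⟨hA, hA'⟩ (h.le.trans hIA))

/-- Maximal `t`-ideals are prime. -/
theorem IsMaximalTIdeal.isPrime [IsDomain R] {M : Ideal R} (hM : IsMaximalTIdeal K M) :
    M.IsPrime := by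
  refine ⟨hM.1.2, fun {a b} hab => ?_⟩
  by_contra! hc
  have key : ∀ c : R, c ∉ M → M < M ⊔ Ideal.span {c} := fun c hc =>
    lt_of_le_of_ne le_sup_left fun e => hc (e ▸ Ideal.mem_sup_right (by simp))
  obtain ⟨J, ⟨h0, h1, h2⟩, hJ⟩ := mem_tClosure.1 (hM.one_mem (key a hc.1))
  obtain ⟨L, ⟨h0', h1', h2'⟩, hL⟩ := mem_tClosure.1 (hM.one_mem (key b hc.2))
  have hle : J * L ≤ M := by
    refine (Ideal.mul_mono h2 h2').trans ?_
    rw [Ideal.sup_mul, Ideal.mul_sup (Ideal.span {a}), Ideal.span_singleton_mul_span_singleton]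
    refine sup_le Ideal.mul_le_left (sup_le Ideal.mul_le_right ?_)
    rwa [Ideal.span_singleton_le_iff_mem]
  have h : (1 : R) ∈ (M : Set R) := by
    rw [← hM.1.1.2]
    exact mem_tClosure.2 ⟨J * L, ⟨mul_ne_zero h0 h0', h1.mul h1', hle⟩, one_mem_vClosure_mul hJ hL⟩
  exact hM.1.2 ((Ideal.eq_top_iff_one M).2 h)

end

section

variable {R : Type*} [CommRing R] (K : Type*) [Field K] [Algebra R K]

/-- The localization `R_P`, as a subset of `K`: all fractions `a / s` with `s ∉ P`. -/
def localizationAt (P : Ideal R) : Set K :=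
  {x | ∃ a s : R, s ∉ P ∧ x * algebraMap R K s = algebraMap R K a}

/-- `T` is `t`-linked over `R`: every finitely generated ideal `I` of `R` with `(R : I) = R`
satisfies `(T : I T) = T`. -/
def IsTLinked (T : Subalgebra R K) : Prop :=
  ∀ I : Ideal R, I.FG → inverse K I = 1 → inverse K (I.map (algebraMap R T)) = 1

/-- The set `Φ(Λ)` of all `t`-ideals that are contained in no member of `Λ`. -/
def tSystem (Λ : Set (Ideal R)) : Set (Ideal R) :=
  {I | IsTIdeal K I ∧ ∀ P ∈ Λ, ¬ I ≤ P}

/-- A `v`-finite ideal is one of the form `J_v` with `J` nonzero and finitely generated. -/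
def IsVFiniteIdeal (I : Ideal R) : Prop :=
  ∃ J : Ideal R, J ≠ ⊥ ∧ J.FG ∧ I = vClosure K J

/-- A set `F` of ideals is `v`-finite if every `t`-ideal in `F` contains a `v`-finite ideal
that is also in `F`. -/
def IsVFiniteSystem (F : Set (Ideal R)) : Prop :=
  ∀ I ∈ F, IsTIdeal K I → ∃ J ∈ F, IsVFiniteIdeal K J ∧ J ≤ I

end

section

variable (R : Type*) [CommRing R] (K : Type*) [Field K] [Algebra R K]

/-- The `t#`-property: distinct sets of maximal `t`-ideals give distinct intersections of
localizations (the empty intersection being `K`). -/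
def IsTSharp : Prop :=
  ∀ S₁ S₂ : Set (Ideal R), S₁ ⊆ {M | IsMaximalTIdeal K M} → S₂ ⊆ {M | IsMaximalTIdeal K M} →
    S₁ ≠ S₂ → (⋂ M ∈ S₁, localizationAt K M) ≠ ⋂ M ∈ S₂, localizationAt K M

/-- A Prüfer `v`-multiplication domain: `R_M` is a valuation domain for every maximal
`t`-ideal `M`. -/
def IsPVMD [IsDomain R] : Prop :=
  ∀ (M : Ideal R) (hM : IsMaximalTIdeal K M),
    haveI : M.IsPrime := hM.isPrime
    ValuationRing (Localization.AtPrime M)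

/-- The ascending chain condition on `t`-primes. -/
def ACCTPrimes : Prop :=
  WellFoundedGT {P : Ideal R // IsTPrime K P}

/-- The ascending chain condition on radical `t`-ideals. -/
def ACCRadicalTIdeals : Prop :=
  WellFoundedGT {I : Ideal R // IsTIdeal K I ∧ I.IsRadical}

end

/-- A prime ideal `P` is branched if there is a `P`-primary ideal different from `P`. -/
def IsBranched {R : Type*} [CommRing R] (P : Ideal R) : Prop :=
  ∃ Q : Ideal R, Q.IsPrimary ∧ Q.radical = P ∧ Q ≠ P

end TSharp

/-!
Over a PVMD `R` every `t`-prime `P` has a valuation domain `R_P`, so that the `t`-primes form a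
forest: those contained in a given one form a chain. This, with the fact that finitely generated
ideals are locally principal, is all that is used of the PVMD property. In particular, the inverse
`J⁻¹` of a finitely generated ideal `J` is contained in `R_P` if, and only if, `J ⊄ P`
(`mem_localizationAt_of_mem_inverse`, `IsValuativeAt.exists_mem_inverse_notMem`).

The equivalence of (1)-(4) is a version for `t`-primes of facts on spectra. The set `Φ(Λ)` is
`v`-finite if each `t`-ideal contained in no `P ∈ Λ` contains a finitely generated ideal with the same
property. Taking for `Λ` the `t`-primes that do not contain the union of an ascending chain of radical
`t`-ideals yields (1) ⟹ (3), and (3) ⟹ (4) is Noetherian induction. For (4) ⟹ (1), a finitely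
generated `J ⊆ I` is enlarged until every `t`-prime containing it contains `I`; each step moves the
finitely many minimal primes of `J_v` not containing `I` strictly up the forest, and the process stops
by the chain condition on `t`-primes (`exists_fg_le_of_isTPrime`). For (2) ⟹ (1), replace `Λ` by its
maximal members.

The link with (6) is that `T_N = R_{N ∩ R}` for each maximal `t`-ideal `N` of a `t`-linked overring
`T` (`IsTLinked.localizationAt_comap`), and that each intersection `⋂_{P ∈ Λ} R_P` over a set of
`t`-primes is a `t`-linked overring. For (1) ⟹ (6), a finitely generated `J` contained in `N ∩ R`
only, among the contractions of a set of maximal `t`-ideals, separates the intersections by means of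
`J⁻¹`. For (6) ⟹ (2), the `t#`-property of `T = ⋂_{P ∈ Λ} R_P` shows that all its maximal `t`-ideals
lie over members of the antichain `Λ` (`comap_mem_of_isTSharp`); if `I` is contained in no member of
`Λ`, it follows that `(I T)_t = T`, and this involves only finitely many elements of `I`.

Finally, (5) and (6) are equivalent since a `t`-prime `P` is branched if, and only if, it is not the
union of a chain of smaller primes, as one sees in the valuation domain `R_P`.
-/

namespace TSharp

/-! ### `v`- and `t`-closures -/

section ClosureOperations

variable {R K : Type*} [CommRing R] [Field K] [Algebra R K]

theorem isTIdeal_iff {I : Ideal R} :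
    IsTIdeal K I ↔ I ≠ ⊥ ∧ ∀ J : Ideal R, J ≠ ⊥ → J.FG → J ≤ I → vClosure K J ≤ I := by
  refine and_congr_right fun hI => ⟨fun h J h0 h1 h2 x hx => ?_, fun h => ?_⟩
  · exact (Set.ext_iff.1 h x).1 (mem_tClosure.2 ⟨J, ⟨h0, h1, h2⟩, hx⟩)
  · refine Set.Subset.antisymm (fun x hx => ?_) fun x hx => ?_
    · obtain ⟨J, ⟨h0, h1, h2⟩, hJ⟩ := mem_tClosure.1 hx
      exact h J h0 h1 h2 hJ
    · obtain ⟨m, hm, hm0⟩ := Submodule.exists_mem_ne_zero_of_ne_bot hI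
      refine mem_tClosure.2 ⟨Ideal.span {x, m}, ⟨fun e => hm0 (Ideal.span_eq_bot.1 e m (by simp)),
        Submodule.fg_span (by simp), ?_⟩, le_vClosure _ (Ideal.subset_span (by simp))⟩
      rw [Ideal.span_le]
      rintro z (rfl | rfl) <;> assumption

theorem IsTIdeal.vClosure_le {I J : Ideal R} (hI : IsTIdeal K I) (h0 : J ≠ ⊥) (h1 : J.FG)
    (h2 : J ≤ I) : vClosure K J ≤ I :=
  (isTIdeal_iff.1 hI).2 J h0 h1 h2

theorem vClosure_mono {I J : Ideal R} (h : I ≤ J) : vClosure K I ≤ vClosure K J :=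
  TSharp.vClosure_le (h.trans (le_vClosure J))

theorem inverse_anti {I J : Ideal R} (h : I ≤ J) : inverse K J ≤ inverse K I := fun _ hy =>
  mem_inverse.2 fun a ha => mem_inverse.1 hy a (h ha)

theorem vClosure_ne_bot {J : Ideal R} (h0 : J ≠ ⊥) : vClosure K J ≠ ⊥ :=
  ne_bot_of_le_ne_bot h0 (le_vClosure J)

theorem isTIdeal_vClosure {J : Ideal R} (h0 : J ≠ ⊥) : IsTIdeal K (vClosure K J) :=
  isTIdeal_iff.2 ⟨vClosure_ne_bot h0, fun _ _ _ h => TSharp.vClosure_le h⟩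

theorem isTIdeal_sInf {A : Ideal R} (h0 : A ≠ ⊥) {S : Set (Ideal R)}
    (hS : ∀ I ∈ S, IsTIdeal K I ∧ A ≤ I) : IsTIdeal K (sInf S) :=
  isTIdeal_iff.2 ⟨ne_bot_of_le_ne_bot h0 (le_sInf fun I hI => (hS I hI).2), fun _ h1 h2 h3 =>
    le_sInf fun I hI => (hS I hI).1.vClosure_le h1 h2 (h3.trans (sInf_le hI))⟩

theorem exists_le_of_fg_of_le_sSup {J : Ideal R} (hJ : J.FG) {S : Set (Ideal R)}
    (hne : S.Nonempty) (hd : DirectedOn (· ≤ ·) S) (h : J ≤ sSup S) : ∃ I ∈ S, J ≤ I :=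
  (CompleteLattice.isCompactElement_iff_le_of_directed_sSup_le _ J).1
    ((Submodule.fg_iff_compact J).1 hJ) S hne hd h

theorem isTIdeal_sSup {S : Set (Ideal R)} (hne : S.Nonempty) (hd : DirectedOn (· ≤ ·) S)
    (hS : ∀ I ∈ S, IsTIdeal K I) : IsTIdeal K (sSup S) := by
  refine isTIdeal_iff.2 ⟨?_, fun J h0 h1 h2 => ?_⟩
  · obtain ⟨I, hI⟩ := hne
    exact ne_bot_of_le_ne_bot (hS I hI).1 (le_sSup hI)
  · obtain ⟨I, hI, hJI⟩ := exists_le_of_fg_of_le_sSup h1 hne hd h2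
    exact ((hS I hI).vClosure_le h0 h1 hJI).trans (le_sSup hI)

theorem exists_isTIdeal_coe_eq_tClosure {I : Ideal R} (hI : I ≠ ⊥) :
    ∃ A : Ideal R, IsTIdeal K A ∧ I ≤ A ∧ (A : Set R) = tClosure K I := by
  let S : Set (Ideal R) := {A | ∃ J : Ideal R, (J ≠ ⊥ ∧ J.FG ∧ J ≤ I) ∧ A = vClosure K J}
  have hsub : ∀ x ∈ I, ∃ J : Ideal R, (J ≠ ⊥ ∧ J.FG ∧ J ≤ I) ∧ x ∈ J := fun x hx => by
    obtain ⟨m, hm, hm0⟩ := Submodule.exists_mem_ne_zero_of_ne_bot hI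
    refine ⟨Ideal.span {x, m}, ⟨fun e => hm0 (Ideal.span_eq_bot.1 e m (by simp)),
        Submodule.fg_span (by simp), ?_⟩, Ideal.subset_span (by simp)⟩
    rw [Ideal.span_le]
    rintro z (rfl | rfl) <;> assumption
  have hne : S.Nonempty := by
    obtain ⟨J, hJ, -⟩ := hsub 0 I.zero_mem
    exact ⟨_, J, hJ, rfl⟩
  have hd : DirectedOn (· ≤ ·) S := by
    rintro _ ⟨J, ⟨h0, h1, h2⟩, rfl⟩ _ ⟨L, ⟨-, h1', h2'⟩, rfl⟩
    exact ⟨_, ⟨J ⊔ L, ⟨ne_bot_of_le_ne_bot h0 le_sup_left, Submodule.FG.sup h1 h1',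
      sup_le h2 h2'⟩, rfl⟩, vClosure_mono le_sup_left, vClosure_mono le_sup_right⟩
  refine ⟨sSup S, isTIdeal_sSup hne hd ?_, fun x hx => ?_, Set.ext fun x => ?_⟩
  · rintro _ ⟨J, hJ, rfl⟩
    exact isTIdeal_vClosure hJ.1
  · obtain ⟨J, hJ, hxJ⟩ := hsub x hx
    exact le_sSup (show vClosure K J ∈ S from ⟨J, hJ, rfl⟩) (le_vClosure J hxJ)
  · rw [SetLike.mem_coe, Submodule.mem_sSup_of_directed hne hd, mem_tClosure]
    constructor
    · rintro ⟨_, ⟨J, hJ, rfl⟩, hx⟩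
      exact ⟨J, hJ, hx⟩
    · rintro ⟨J, hJ, hx⟩
      exact ⟨_, ⟨J, hJ, rfl⟩, hx⟩

theorem IsTIdeal.exists_le_isMaximalTIdeal {I : Ideal R} (hI : IsTIdeal K I) (h1 : I ≠ ⊤) :
    ∃ M : Ideal R, IsMaximalTIdeal K M ∧ I ≤ M := by
  have hchain : ∀ c ⊆ {A : Ideal R | IsTIdeal K A ∧ A ≠ ⊤}, IsChain (· ≤ ·) c → ∀ A ∈ c,
      ∃ B ∈ {A : Ideal R | IsTIdeal K A ∧ A ≠ ⊤}, ∀ C ∈ c, C ≤ B := by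
    intro c hc hch A hA
    refine ⟨sSup c, ⟨isTIdeal_sSup ⟨A, hA⟩ hch.directedOn fun B hB => (hc hB).1, fun e => ?_⟩,
      fun B hB => le_sSup hB⟩
    obtain ⟨B, hB, hB'⟩ := (Submodule.mem_sSup_of_directed ⟨A, hA⟩ hch.directedOn).1
      (e ▸ Submodule.mem_top : (1 : R) ∈ sSup c)
    exact (hc hB).2 ((Ideal.eq_top_iff_one B).2 hB')
  obtain ⟨M, hIM, hM⟩ := zorn_le_nonempty₀ _ hchain I ⟨hI, h1⟩
  exact ⟨M, hM, hIM⟩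

/-- An ideal avoiding all maximal `t`-ideals has `t`-closure `R`, and this is witnessed by a
finitely generated subideal. -/
theorem exists_fg_one_mem_vClosure {I : Ideal R} (h0 : I ≠ ⊥)
    (h : ∀ M : Ideal R, IsMaximalTIdeal K M → ¬ I ≤ M) :
    ∃ J : Ideal R, (J ≠ ⊥ ∧ J.FG ∧ J ≤ I) ∧ 1 ∈ vClosure K J := by
  obtain ⟨A, hA, hIA, hAI⟩ := exists_isTIdeal_coe_eq_tClosure (K := K) h0
  have hA' : A = ⊤ := by
    by_contra hA'
    obtain ⟨M, hM, hAM⟩ := hA.exists_le_isMaximalTIdeal hA'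
    exact h M hM (hIA.trans hAM)
  have : (1 : R) ∈ (A : Set R) := by simp [hA']
  exact mem_tClosure.1 (hAI ▸ this)

theorem inverse_eq_one_iff {I : Ideal R} : inverse K I = 1 ↔ 1 ∈ vClosure K I := by
  rw [mem_vClosure]
  refine ⟨fun h y hy => by simpa [h] using hy, fun h => le_antisymm (fun y hy => ?_) ?_⟩
  · simpa using h y hy
  · intro y hy
    refine mem_inverse.2 fun a _ => ?_
    obtain ⟨r, rfl⟩ := Submodule.mem_one.1 hy
    exact Submodule.mem_one.2 ⟨r * a, map_mul _ _ _⟩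

theorem IsTPrime.one_notMem_vClosure {P J : Ideal R} (hP : IsTPrime K P) (hJ : J ≠ ⊥)
    (h1 : J.FG) (h : J ≤ P) : 1 ∉ vClosure K J := fun h' =>
  hP.1.ne_top ((Ideal.eq_top_iff_one P).2 (hP.2.vClosure_le hJ h1 h h'))

theorem IsTPrime.exists_le_isMaximalTIdeal {P : Ideal R} (hP : IsTPrime K P) :
    ∃ M : Ideal R, IsMaximalTIdeal K M ∧ P ≤ M :=
  hP.2.exists_le_isMaximalTIdeal hP.1.ne_top

theorem IsMaximalTIdeal.isTPrime [IsDomain R] {M : Ideal R} (hM : IsMaximalTIdeal K M) :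
    IsTPrime K M :=
  ⟨hM.isPrime, hM.1.1⟩

theorem mul_mem_vClosure_mul {I J : Ideal R} {a b : R} (ha : a ∈ vClosure K I)
    (hb : b ∈ vClosure K J) : a * b ∈ vClosure K (I * J) := by
  refine mem_vClosure.2 fun y hy => ?_
  have := mem_vClosure.1 hb (algebraMap R K a * y) <| mem_inverse.2 fun j hj => by
    have := mem_vClosure.1 ha (y * algebraMap R K j) <| mem_inverse.2 fun i hi => by
      have := mem_inverse.1 hy (i * j) (Ideal.mul_mem_mul hi hj)
      rwa [map_mul, mul_comm (algebraMap R K i), ← mul_assoc] at this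
    rwa [← mul_assoc] at this
  rwa [← mul_assoc, mul_comm (algebraMap R K b), ← map_mul] at this

theorem pow_mem_vClosure_pow {I : Ideal R} {a : R} (ha : a ∈ vClosure K I) (n : ℕ) :
    a ^ n ∈ vClosure K (I ^ n) := by
  induction n with
  | zero => exact le_vClosure _ (by simp)
  | succ n ih => rw [pow_succ, pow_succ]; exact mul_mem_vClosure_mul ih ha

end ClosureOperations

/-! ### Minimal primes of `t`-ideals -/

section MinimalPrimes

variable {R : Type*} [CommRing R]

theorem exists_mul_pow_mem_of_mem_minimalPrimes {I P : Ideal R} (hP : P ∈ I.minimalPrimes)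
    {x : R} (hx : x ∈ P) : ∃ s ∉ P, ∃ n : ℕ, s * x ^ n ∈ I := by
  have hPp : P.IsPrime := hP.1.1
  by_contra! hc
  obtain ⟨q, hq, hIq, hd⟩ := Ideal.exists_le_prime_disjoint I (P.primeCompl ⊔ Submonoid.powers x) <|
    Set.disjoint_left.2 fun y hy hy' => by
      obtain ⟨s, hs, _, ⟨n, rfl⟩, rfl⟩ := Submonoid.mem_sup.1 hy'
      exact hc s hs n hy
  have hqP : q ≤ P := fun y hy => by
    by_contra hyP
    exact Set.disjoint_left.1 hd hy (Submonoid.mem_sup_left hyP)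
  exact Set.disjoint_left.1 hd (hP.2 ⟨hq, hIq⟩ hqP hx)
    (Submonoid.mem_sup_right (Submonoid.mem_powers x))

theorem exists_span_mul_pow_le_of_mem_minimalPrimes {I P J : Ideal R} (hP : P ∈ I.minimalPrimes)
    (hJ : J.FG) (hJP : J ≤ P) : ∃ s ∉ P, ∃ n : ℕ, Ideal.span {s} * J ^ n ≤ I := by
  have hPp : P.IsPrime := hP.1.1
  induction J, hJ using Submodule.fg_induction with
  | singleton x =>
    obtain ⟨s, hs, n, h⟩ := exists_mul_pow_mem_of_mem_minimalPrimes hP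
      (hJP (Submodule.mem_span_singleton_self x))
    refine ⟨s, hs, n, ?_⟩
    rw [Ideal.submodule_span_eq, Ideal.span_singleton_pow, Ideal.span_singleton_mul_span_singleton,
      Ideal.span_singleton_le_iff_mem]
    exact h
  | sup A B _ _ hA hB =>
    obtain ⟨s, hs, n, h⟩ := hA (le_sup_left.trans hJP)
    obtain ⟨t, ht, m, h'⟩ := hB (le_sup_right.trans hJP)
    refine ⟨s * t, fun h => (hPp.mem_or_mem h).elim hs ht, n + m, ?_⟩
    refine (Ideal.mul_mono_right Ideal.sup_pow_add_le_pow_sup_pow).trans ?_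
    rw [← Ideal.span_singleton_mul_span_singleton, Ideal.mul_sup]
    refine sup_le ?_ ?_
    · rw [mul_comm (Ideal.span {s}), mul_assoc]
      exact Ideal.mul_le_right.trans h
    · rw [mul_assoc]
      exact Ideal.mul_le_right.trans h'

variable {K : Type*} [IsDomain R] [Field K] [Algebra R K]

/-- Minimal primes of `t`-ideals are `t`-primes: if `J ⊆ P` is finitely generated, then
`s Jⁿ ⊆ I` for some `s ∉ P`, hence `s rⁿ ∈ (s Jⁿ)_v ⊆ I ⊆ P` for all `r ∈ J_v`. -/
theorem IsTIdeal.isTPrime_of_mem_minimalPrimes {I P : Ideal R} (hI : IsTIdeal K I)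
    (hP : P ∈ I.minimalPrimes) : IsTPrime K P := by
  have hPp : P.IsPrime := hP.1.1
  refine ⟨hPp, isTIdeal_iff.2 ⟨ne_bot_of_le_ne_bot hI.1 hP.1.2, fun J h0 h1 h2 r hr => ?_⟩⟩
  obtain ⟨s, hs, n, h⟩ := exists_span_mul_pow_le_of_mem_minimalPrimes hP h1 h2
  have hs0 : s ≠ 0 := fun e => hs (e ▸ P.zero_mem)
  have hmem : s * r ^ n ∈ P := hP.1.2 <| hI.vClosure_le
    (mul_ne_zero (by simpa using hs0) (pow_ne_zero n h0))
    ((Submodule.fg_span_singleton s).mul h1.pow) h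
    (mul_mem_vClosure_mul (le_vClosure _ (Ideal.mem_span_singleton_self s))
      (pow_mem_vClosure_pow hr n))
  exact hPp.mem_of_pow_mem n ((hPp.mem_or_mem hmem).resolve_left hs)

theorem IsTIdeal.exists_isTPrime_notMem {I : Ideal R} (hI : IsTIdeal K I) {x : R}
    (hx : x ∉ I.radical) : ∃ P : Ideal R, IsTPrime K P ∧ I ≤ P ∧ x ∉ P := by
  rw [← Ideal.sInf_minimalPrimes, Ideal.mem_sInf] at hx
  push Not at hx
  obtain ⟨P, hP, hxP⟩ := hx
  exact ⟨P, hI.isTPrime_of_mem_minimalPrimes hP, hP.1.2, hxP⟩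

end MinimalPrimes

/-! ### Primes whose localization is a valuation domain -/

section Valuation

variable {R : Type*} [CommRing R]

/-- For a prime ideal `P` of a domain `R`, this says that `R_P` is a valuation domain: of any two
elements of `R`, one divides the other up to a factor outside of `P`.  Stated inside of `R`, so
that it is evidently inherited by smaller primes. -/
def IsValuativeAt (P : Ideal R) : Prop :=
  ∀ x y : R, ∃ s ∉ P, x ∣ s * y ∨ y ∣ s * x

theorem IsValuativeAt.anti {P Q : Ideal R} (hP : IsValuativeAt P) (h : Q ≤ P) :
    IsValuativeAt Q := fun x y =>
  let ⟨s, hs, h'⟩ := hP x y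
  ⟨s, fun hsQ => hs (h hsQ), h'⟩

theorem isValuativeAt_of_valuationRing [IsDomain R] (P : Ideal R) [P.IsPrime]
    [ValuationRing (Localization.AtPrime P)] : IsValuativeAt P := by
  have key : ∀ x y : R, algebraMap R (Localization.AtPrime P) x ∣ algebraMap R _ y →
      ∃ s ∉ P, x ∣ s * y := by
    rintro x y ⟨c, hc⟩
    obtain ⟨⟨r, s⟩, rfl⟩ := IsLocalization.mk'_surjective P.primeCompl c
    refine ⟨s, s.2, r, IsLocalization.injective (Localization.AtPrime P)
      P.primeCompl_le_nonZeroDivisors ?_⟩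
    simp only at hc
    rw [map_mul, hc, mul_left_comm, mul_comm (algebraMap R _ (s : R)), IsLocalization.mk'_spec,
      map_mul]
  intro x y
  rcases ValuationRing.dvd_total (algebraMap R (Localization.AtPrime P) x) (algebraMap R _ y)
    with h | h
  · obtain ⟨s, hs, h⟩ := key x y h
    exact ⟨s, hs, Or.inl h⟩
  · obtain ⟨s, hs, h⟩ := key y x h
    exact ⟨s, hs, Or.inr h⟩

theorem IsValuativeAt.le_total {P Q₁ Q₂ : Ideal R} (hP : IsValuativeAt P) (h₁ : Q₁.IsPrime)
    (h₂ : Q₂.IsPrime) (hQ₁ : Q₁ ≤ P) (hQ₂ : Q₂ ≤ P) : Q₁ ≤ Q₂ ∨ Q₂ ≤ Q₁ := by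
  by_contra! hc
  obtain ⟨x, hx, hx'⟩ := SetLike.not_le_iff_exists.1 hc.1
  obtain ⟨y, hy, hy'⟩ := SetLike.not_le_iff_exists.1 hc.2
  obtain ⟨s, hs, h | h⟩ := hP x y
  · exact (h₁.mem_or_mem (Ideal.mem_of_dvd _ h hx)).elim (fun h => hs (hQ₁ h)) hy'
  · exact (h₂.mem_or_mem (Ideal.mem_of_dvd _ h hy)).elim (fun h => hs (hQ₂ h)) hx'

/-- Finitely generated ideals of a valuation domain are principal. -/
theorem IsValuativeAt.exists_dvd_of_fg {P : Ideal R} (hP : IsValuativeAt P) (hp : P.IsPrime)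
    {J : Ideal R} (hJ : J.FG) : ∃ a ∈ J, ∃ s ∉ P, ∀ j ∈ J, a ∣ s * j := by
  induction J, hJ using Submodule.fg_induction with
  | singleton x =>
    refine ⟨x, Submodule.mem_span_singleton_self x, 1, hp.one_notMem, fun j hj => ?_⟩
    rw [one_mul]
    exact Ideal.mem_span_singleton.1 hj
  | sup A B _ _ hA hB =>
    obtain ⟨a, ha, s, hs, h⟩ := hA
    obtain ⟨b, hb, t, ht, h'⟩ := hB
    obtain ⟨u, hu, hab⟩ := hP a b
    have hstu : u * (s * t) ∉ P := fun h => (hp.mem_or_mem h).elim hu fun h =>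
      (hp.mem_or_mem h).elim hs ht
    rcases hab with hab | hab
    · refine ⟨a, Submodule.mem_sup_left ha, u * (s * t), hstu, fun j hj => ?_⟩
      obtain ⟨x, hx, y, hy, rfl⟩ := Submodule.mem_sup.1 hj
      rw [show u * (s * t) * (x + y) = s * x * (u * t) + u * (t * y) * s by ring]
      exact dvd_add (dvd_mul_of_dvd_left (h x hx) _)
        (dvd_mul_of_dvd_left (hab.trans (mul_dvd_mul_left u (h' y hy))) _)
    · refine ⟨b, Submodule.mem_sup_right hb, u * (s * t), hstu, fun j hj => ?_⟩
      obtain ⟨x, hx, y, hy, rfl⟩ := Submodule.mem_sup.1 hj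
      rw [show u * (s * t) * (x + y) = u * (s * x) * t + t * y * (u * s) by ring]
      exact dvd_add (dvd_mul_of_dvd_left (hab.trans (mul_dvd_mul_left u (h x hx))) _)
        (dvd_mul_of_dvd_left (h' y hy) _)

variable {K : Type*} [Field K] [Algebra R K]

theorem algebraMap_mem_localizationAt {P : Ideal R} (hp : P.IsPrime) (r : R) :
    algebraMap R K r ∈ localizationAt K P :=
  ⟨r, 1, hp.one_notMem, by simp⟩

theorem localizationAt_anti {P Q : Ideal R} (h : P ≤ Q) :
    localizationAt K Q ⊆ localizationAt K P := fun _ ⟨a, s, hs, e⟩ => ⟨a, s, fun hs' => hs (h hs'), e⟩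

/-- The inverse of an ideal that is not contained in `P` is contained in `R_P`. -/
theorem mem_localizationAt_of_mem_inverse {P J : Ideal R} (h : ¬ J ≤ P) {y : K}
    (hy : y ∈ inverse K J) : y ∈ localizationAt K P := by
  obtain ⟨j, hj, hjP⟩ := SetLike.not_le_iff_exists.1 h
  obtain ⟨r, hr⟩ := Submodule.mem_one.1 (mem_inverse.1 hy j hj)
  exact ⟨r, j, hjP, hr.symm⟩

variable [IsDomain R]

theorem IsPVMD.isValuativeAt (hR : IsPVMD R K) {M Q : Ideal R} (hM : IsMaximalTIdeal K M)
    (h : Q ≤ M) : IsValuativeAt Q := by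
  have : M.IsPrime := hM.isPrime
  have : ValuationRing (Localization.AtPrime M) := hR M hM
  exact (isValuativeAt_of_valuationRing M).anti h

theorem IsPVMD.isValuativeAt_of_isTPrime (hR : IsPVMD R K) {P : Ideal R} (hP : IsTPrime K P) :
    IsValuativeAt P :=
  let ⟨_, hM, h⟩ := hP.exists_le_isMaximalTIdeal
  hR.isValuativeAt hM h

variable [FaithfulSMul R K]

/-- If `J R_P = a R_P`, then some `s / a` with `s ∉ P` lies in the inverse of `J`. -/
theorem IsValuativeAt.exists_div_mem_inverse {P J : Ideal R} (hP : IsValuativeAt P)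
    (hp : P.IsPrime) (hJ : J.FG) (h0 : J ≠ ⊥) :
    ∃ a ∈ J, a ≠ 0 ∧ ∃ s ∉ P, algebraMap R K s / algebraMap R K a ∈ inverse K J := by
  obtain ⟨a, ha, s, hs, h⟩ := hP.exists_dvd_of_fg hp hJ
  have ha0 : a ≠ 0 := by
    rintro rfl
    refine h0 ((Submodule.eq_bot_iff _).2 fun j hj => ?_)
    refine (mul_eq_zero.1 (zero_dvd_iff.1 (h j hj))).resolve_left fun e => hs (e ▸ P.zero_mem)
  have ha0' : algebraMap R K a ≠ 0 := by
    simpa using (FaithfulSMul.algebraMap_injective R K).ne ha0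
  refine ⟨a, ha, ha0, s, hs, mem_inverse.2 fun j hj => ?_⟩
  obtain ⟨c, hc⟩ := h j hj
  refine Submodule.mem_one.2 ⟨c, ?_⟩
  rw [div_mul_eq_mul_div, ← map_mul, hc, map_mul, mul_div_cancel_left₀ _ ha0']

/-- The inverse of a finitely generated ideal `J ⊆ P` is not contained in `R_P`, if the latter is
a valuation domain. -/
theorem IsValuativeAt.exists_mem_inverse_notMem {P J : Ideal R} (hP : IsValuativeAt P)
    (hp : P.IsPrime) (hP0 : P ≠ ⊥) (hJ : J.FG) (h : J ≤ P) :
    ∃ y ∈ inverse K J, y ∉ localizationAt K P := by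
  -- Enlarging `J` by a nonzero element of `P` makes it nonzero.
  obtain ⟨m, hm, hm0⟩ := Submodule.exists_mem_ne_zero_of_ne_bot hP0
  have hle : J ⊔ Ideal.span {m} ≤ P := sup_le h ((Ideal.span_singleton_le_iff_mem _).2 hm)
  obtain ⟨a, ha, ha0, s, hs, hy⟩ := hP.exists_div_mem_inverse (K := K) hp
    (Submodule.FG.sup hJ (Submodule.fg_span_singleton m))
    (ne_bot_of_le_ne_bot (by simpa using hm0) (le_sup_right : Ideal.span {m} ≤ J ⊔ Ideal.span {m}))
  refine ⟨_, inverse_anti le_sup_left hy, ?_⟩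
  rintro ⟨c, t, ht, e⟩
  have ha0' : algebraMap R K a ≠ 0 := by
    simpa using (FaithfulSMul.algebraMap_injective R K).ne ha0
  rw [div_mul_eq_mul_div, div_eq_iff ha0', ← map_mul, ← map_mul] at e
  have := FaithfulSMul.algebraMap_injective R K e
  exact (hp.mem_or_mem (this ▸ P.mul_mem_left c (hle ha) : s * t ∈ P)).elim hs ht

theorem IsValuativeAt.isTPrime {P : Ideal R} (hP : IsValuativeAt P) (hp : P.IsPrime)
    (h0 : P ≠ ⊥) : IsTPrime K P := by
  refine ⟨hp, isTIdeal_iff.2 ⟨h0, fun J hJ0 hJ hJP r hr => ?_⟩⟩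
  obtain ⟨a, ha, ha0, s, hs, hy⟩ := hP.exists_div_mem_inverse (K := K) hp hJ hJ0
  have ha0' : algebraMap R K a ≠ 0 := by
    simpa using (FaithfulSMul.algebraMap_injective R K).ne ha0
  obtain ⟨c, hc⟩ := Submodule.mem_one.1 (mem_vClosure.1 hr _ hy)
  rw [mul_div_assoc', eq_div_iff ha0', ← map_mul, ← map_mul] at hc
  have := FaithfulSMul.algebraMap_injective R K hc
  exact (hp.mem_or_mem (this ▸ P.mul_mem_left c (hJP ha) : r * s ∈ P)).resolve_right hs

end Valuation

/-! ### Chain conditions and `v`-finiteness -/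

section ChainConditions

variable {R K : Type*} [CommRing R] [Field K] [Algebra R K]

theorem isVFiniteSystem_tSystem_iff {Λ : Set (Ideal R)} (hΛ : ∀ P ∈ Λ, IsTPrime K P) :
    IsVFiniteSystem K (tSystem K Λ) ↔ ∀ I : Ideal R, IsTIdeal K I → (∀ P ∈ Λ, ¬ I ≤ P) →
      ∃ J : Ideal R, J ≠ ⊥ ∧ J.FG ∧ J ≤ I ∧ ∀ P ∈ Λ, ¬ J ≤ P := by
  constructor
  · intro h I hI hIΛ
    obtain ⟨_, ⟨-, hL⟩, ⟨J, h0, h1, rfl⟩, hJI⟩ := h I ⟨hI, hIΛ⟩ hI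
    exact ⟨J, h0, h1, (le_vClosure J).trans hJI, fun P hP hJP =>
      hL P hP ((hΛ P hP).2.vClosure_le h0 h1 hJP)⟩
  · rintro h I ⟨-, hIΛ⟩ hI
    obtain ⟨J, h0, h1, h2, hJ⟩ := h I hI hIΛ
    exact ⟨vClosure K J, ⟨isTIdeal_vClosure h0, fun P hP hJP => hJ P hP ((le_vClosure J).trans hJP)⟩,
      ⟨J, h0, h1, rfl⟩, hI.vClosure_le h0 h1 h2⟩

theorem wellFoundedGT_subtype_of_chain {p : Ideal R → Prop}
    (h : ∀ f : ℕ →o Ideal R, (∀ n, p (f n)) → ∃ n, ∀ m, f m ≤ f n) :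
    WellFoundedGT {I : Ideal R // p I} := by
  refine wellFoundedGT_iff_monotone_chain_condition.2 fun a => ?_
  obtain ⟨n, hn⟩ := h ⟨fun n => (a n : Ideal R), fun _ _ hmn => a.mono hmn⟩ fun n => (a n).2
  exact ⟨n, fun m hm => le_antisymm (a.mono hm) (hn m)⟩

theorem directedOn_range_orderHom (f : ℕ →o Ideal R) : DirectedOn (· ≤ ·) (Set.range f) :=
  (Monotone.directed_le f.mono).directedOn_range

/-- The union of an ascending chain of radical `t`-ideals is a radical `t`-ideal `I`; applying the
hypothesis to the `t`-primes that do not contain `I` gives a finitely generated `J ⊆ I` contained in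
the same `t`-primes as `I`. The chain becomes stationary as soon as it swallows `J`. -/
theorem accRadicalTIdeals_of_isVFiniteSystem [IsDomain R]
    (h : ∀ Λ : Set (Ideal R), (∀ P ∈ Λ, IsTPrime K P) → IsVFiniteSystem K (tSystem K Λ)) :
    ACCRadicalTIdeals R K := by
  refine wellFoundedGT_subtype_of_chain fun f hf => ?_
  have hI : IsTIdeal K (sSup (Set.range f)) :=
    isTIdeal_sSup (Set.range_nonempty f) (directedOn_range_orderHom f)
      (by rintro _ ⟨n, rfl⟩; exact (hf n).1)
  have hΛ : ∀ P ∈ {P : Ideal R | IsTPrime K P ∧ ¬ sSup (Set.range f) ≤ P}, IsTPrime K P :=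
    fun P hP => hP.1
  obtain ⟨J, -, hJ, hJI, hJΛ⟩ := (isVFiniteSystem_tSystem_iff hΛ).1 (h _ hΛ) _ hI fun P hP => hP.2
  obtain ⟨_, ⟨n, rfl⟩, hn⟩ := exists_le_of_fg_of_le_sSup hJ (Set.range_nonempty f)
    (directedOn_range_orderHom f) hJI
  refine ⟨n, fun m x hx => ?_⟩
  by_contra hxn
  obtain ⟨P, hP, hnP, hxP⟩ := (hf n).1.exists_isTPrime_notMem fun hx => hxn ((hf n).2 hx)
  refine hJΛ P ⟨hP, fun hle => hxP ?_⟩ (hn.trans hnP)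
  exact hle ((le_sSup (Set.mem_range_self m) : f m ≤ _) hx)

theorem ACCRadicalTIdeals.accTPrimes (h : ACCRadicalTIdeals R K) : ACCTPrimes R K := by
  have : WellFoundedGT {I : Ideal R // IsTIdeal K I ∧ I.IsRadical} := h
  let f : {P : Ideal R // IsTPrime K P} → {I : Ideal R // IsTIdeal K I ∧ I.IsRadical} :=
    fun P => ⟨P, P.2.2, P.2.1.isRadical⟩
  have hf : StrictMono f := fun _ _ h => h
  exact hf.wellFoundedGT

/-- Noetherian induction: if `x y ∈ A` with `x, y ∉ A`, then each minimal prime of `A` is minimal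
over one of the strictly larger radical `t`-ideals obtained by adjoining `x` or `y`. -/
theorem ACCRadicalTIdeals.finite_minimalPrimes [IsDomain R] (h : ACCRadicalTIdeals R K)
    {I : Ideal R} (hI : IsTIdeal K I) : I.minimalPrimes.Finite := by
  have : WellFoundedGT {I : Ideal R // IsTIdeal K I ∧ I.IsRadical} := h
  have key : ∀ A : {I : Ideal R // IsTIdeal K I ∧ I.IsRadical}, A.1.minimalPrimes.Finite := by
    intro A
    induction A using WellFoundedGT.induction with
    | ind A ih =>
    obtain ⟨A, hA, hAr⟩ := A
    rcases eq_or_ne A ⊤ with rfl | hA1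
    · simp [Ideal.minimalPrimes_top]
    by_cases hp : A.IsPrime
    · simp [Ideal.minimalPrimes_eq_subsingleton_self]
    obtain ⟨x, hx, y, hy, hxy⟩ := (Ideal.not_isPrime_iff.1 hp).resolve_left hA1
    -- The radical `t`-ideal generated by `A` and `z`.
    let B : R → Ideal R := fun z => sInf {P | IsTPrime K P ∧ A ≤ P ∧ z ∈ P}
    have hAB : ∀ z, A ≤ B z := fun z => le_sInf fun P hP => hP.2.1
    have hfin : ∀ z ∉ A, (B z).minimalPrimes.Finite := fun z hz => by
      refine ih ⟨B z, isTIdeal_sInf hA.1 fun P hP => ⟨hP.1.2, hP.2.1⟩, fun r hr => ?_⟩ ?_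
      · refine Ideal.mem_sInf.2 fun {P} hP => hP.1.1.isRadical (Ideal.radical_mono ?_ hr)
        exact sInf_le hP
      · refine lt_of_le_of_ne (hAB z) fun e => hz ?_
        have hzB : z ∈ B z := Ideal.mem_sInf.2 fun {P} hP => hP.2.2
        exact (show A = B z from congrArg Subtype.val e) ▸ hzB
    have hmin : ∀ z, ∀ P ∈ A.minimalPrimes, z ∈ P → P ∈ (B z).minimalPrimes := fun z P hP hz =>
      ⟨⟨hP.1.1, sInf_le ⟨hA.isTPrime_of_mem_minimalPrimes hP, hP.1.2, hz⟩⟩, fun q hq hqP =>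
        hP.2 ⟨hq.1, (hAB z).trans hq.2⟩ hqP⟩
    refine ((hfin x hx).union (hfin y hy)).subset fun P hP => ?_
    exact (hP.1.1.mem_or_mem (hP.1.2 hxy)).imp (hmin x P hP) (hmin y P hP)
  have hrad : IsTIdeal K I.radical := by
    rw [← Ideal.sInf_minimalPrimes]
    exact isTIdeal_sInf hI.1 fun P hP => ⟨(hI.isTPrime_of_mem_minimalPrimes hP).2, hP.1.2⟩
  rw [← Ideal.radical_minimalPrimes]
  exact key ⟨I.radical, hrad, Ideal.radical_isRadical I⟩

theorem isVFiniteSystem_of_antichain (hacc : ACCTPrimes R K)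
    (h : ∀ Λ : Set (Ideal R), (∀ P ∈ Λ, IsTPrime K P) → IsAntichain (· ≤ ·) Λ →
      IsVFiniteSystem K (tSystem K Λ))
    (Λ : Set (Ideal R)) (hΛ : ∀ P ∈ Λ, IsTPrime K P) : IsVFiniteSystem K (tSystem K Λ) := by
  -- By the chain condition, every member of `Λ` is contained in a maximal member of `Λ`.
  have : WellFoundedGT {P : Ideal R // IsTPrime K P} := hacc
  have hΛ' : ∀ P ∈ {P | Maximal (· ∈ Λ) P}, IsTPrime K P := fun P hP => hΛ P hP.1
  have hmax : ∀ P ∈ Λ, ∃ Q, Maximal (· ∈ Λ) Q ∧ P ≤ Q := fun P hP => by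
    obtain ⟨⟨Q, hQ⟩, ⟨hQΛ, hPQ⟩, hQm⟩ := WellFounded.has_min (wellFounded_gt
      (α := {P : Ideal R // IsTPrime K P})) {Q | Q.1 ∈ Λ ∧ P ≤ Q.1} ⟨⟨P, hΛ P hP⟩, hP, le_rfl⟩
    refine ⟨Q, ⟨hQΛ, fun L hL hQL => ?_⟩, hPQ⟩
    by_contra hLQ
    exact hQm ⟨L, hΛ L hL⟩ ⟨hL, hPQ.trans hQL⟩ (lt_of_le_not_ge hQL hLQ)
  refine (isVFiniteSystem_tSystem_iff hΛ).2 fun I hI hIΛ => ?_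
  obtain ⟨J, h0, h1, h2, hJ⟩ := (isVFiniteSystem_tSystem_iff hΛ').1
    (h _ hΛ' (setOfPred_maximal_antichain _)) I hI fun P hP => hIΛ P hP.1
  exact ⟨J, h0, h1, h2, fun P hP hJP =>
    let ⟨Q, hQ, hPQ⟩ := hmax P hP
    hJ Q hQ (hJP.trans hPQ)⟩

variable [IsDomain R]

/-- The inductive step for `TSharp.isVFiniteSystem_of_finite_minimalPrimes`. If `I ⊄ p`, enlarge
`J` so that `J ⊄ p`. A `t`-prime containing both `J` and `p` contains a minimal prime of `J_v`,
which is comparable to `p`, and hence strictly contains it; there are only finitely many such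
minimal primes, and the induction hypothesis applies to each. -/
theorem exists_fg_le_of_isTPrime (hR : IsPVMD R K) (hacc : ACCTPrimes R K)
    (hfin : ∀ I : Ideal R, I ≠ ⊥ → I.FG → (vClosure K I).minimalPrimes.Finite) {I : Ideal R}
    (p : {P : Ideal R // IsTPrime K P}) (J : Ideal R) (h0 : J ≠ ⊥) (h1 : J.FG) (h2 : J ≤ I) :
    ∃ J' : Ideal R, J'.FG ∧ J ≤ J' ∧ J' ≤ I ∧
      ∀ Q : Ideal R, IsTPrime K Q → p.1 ≤ Q → J' ≤ Q → I ≤ Q := by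
  have : WellFoundedGT {P : Ideal R // IsTPrime K P} := hacc
  induction p using WellFoundedGT.induction generalizing J with
  | ind p ih =>
  by_cases hIp : I ≤ p.1
  · exact ⟨J, h1, le_rfl, h2, fun Q _ hpQ _ => hIp.trans hpQ⟩
  obtain ⟨x, hxI, hxp⟩ := SetLike.not_le_iff_exists.1 hIp
  have hJ0 : J ⊔ Ideal.span {x} ≠ ⊥ := ne_bot_of_le_ne_bot h0 le_sup_left
  have hJ1 : (J ⊔ Ideal.span {x}).FG := Submodule.FG.sup h1 (Submodule.fg_span_singleton x)
  have hJ2 : J ⊔ Ideal.span {x} ≤ I := sup_le h2 ((Ideal.span_singleton_le_iff_mem _).2 hxI)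
  have hxJ : x ∈ J ⊔ Ideal.span {x} := Ideal.mem_sup_right (Ideal.mem_span_singleton_self x)
  let S : Set (Ideal R) := {q ∈ (vClosure K (J ⊔ Ideal.span {x})).minimalPrimes | p.1 < q}
  have : Finite S := ((hfin _ hJ0 hJ1).subset fun q hq => hq.1).to_subtype
  have hS : ∀ q : S, IsTPrime K q.1 := fun q =>
    (isTIdeal_vClosure hJ0).isTPrime_of_mem_minimalPrimes q.2.1
  choose L hL1 hL2 hL3 hL4 using fun q : S => ih ⟨q, hS q⟩ q.2.2 _ hJ0 hJ1 hJ2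
  refine ⟨(J ⊔ Ideal.span {x}) ⊔ ⨆ q, L q, Submodule.FG.sup hJ1 (Submodule.fg_iSup L hL1),
    le_sup_left.trans le_sup_left, sup_le hJ2 (iSup_le hL3), fun Q hQ hpQ hLQ => ?_⟩
  have hQp := hQ.1
  obtain ⟨q, hq, hqQ⟩ := Ideal.exists_minimalPrimes_le
    (hQ.2.vClosure_le hJ0 hJ1 (le_sup_left.trans hLQ))
  have hxq : x ∈ q := hq.1.2 (le_vClosure _ hxJ)
  have hpq : p.1 < q := by
    refine lt_of_le_not_ge ?_ fun h => hxp (h hxq)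
    exact ((hR.isValuativeAt_of_isTPrime hQ).le_total p.2.1 hq.1.1 hpQ hqQ).resolve_right
      fun h => hxp (h hxq)
  exact hL4 ⟨q, hq, hpq⟩ Q hQ hqQ ((le_iSup L ⟨q, hq, hpq⟩).trans (le_sup_right.trans hLQ))

theorem isVFiniteSystem_of_finite_minimalPrimes (hR : IsPVMD R K) (hacc : ACCTPrimes R K)
    (hfin : ∀ I : Ideal R, I ≠ ⊥ → I.FG → (vClosure K I).minimalPrimes.Finite)
    (Λ : Set (Ideal R)) (hΛ : ∀ P ∈ Λ, IsTPrime K P) : IsVFiniteSystem K (tSystem K Λ) := by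
  refine (isVFiniteSystem_tSystem_iff hΛ).2 fun I hI hIΛ => ?_
  obtain ⟨a, haI, ha0⟩ := Submodule.exists_mem_ne_zero_of_ne_bot hI.1
  have h0 : Ideal.span {a} ≠ ⊥ := by simpa using ha0
  have h1 : (Ideal.span {a}).FG := Submodule.fg_span_singleton a
  have h2 : Ideal.span {a} ≤ I := (Ideal.span_singleton_le_iff_mem _).2 haI
  have hS : ∀ q : (vClosure K (Ideal.span {a})).minimalPrimes, IsTPrime K q.1 := fun q =>
    (isTIdeal_vClosure h0).isTPrime_of_mem_minimalPrimes q.2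
  have : Finite (vClosure K (Ideal.span {a})).minimalPrimes := (hfin _ h0 h1).to_subtype
  choose L hL1 hL2 hL3 hL4 using fun q : (vClosure K (Ideal.span {a})).minimalPrimes =>
    exists_fg_le_of_isTPrime hR hacc hfin ⟨q, hS q⟩ _ h0 h1 h2
  refine ⟨Ideal.span {a} ⊔ ⨆ q, L q, ne_bot_of_le_ne_bot h0 le_sup_left,
    Submodule.FG.sup h1 (Submodule.fg_iSup L hL1), sup_le h2 (iSup_le hL3), fun P hP hLP => ?_⟩
  have hPp := (hΛ P hP).1
  obtain ⟨q, hq, hqP⟩ := Ideal.exists_minimalPrimes_le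
    ((hΛ P hP).2.vClosure_le h0 h1 (le_sup_left.trans hLP))
  exact hIΛ P hP
    (hL4 ⟨q, hq⟩ P (hΛ P hP) hqP ((le_iSup L ⟨q, hq⟩).trans (le_sup_right.trans hLP)))

end ChainConditions

/-! ### Branched primes -/

section Branched

variable {R K : Type*} [CommRing R] [Field K] [Algebra R K]

theorem isPrime_sSup_of_directedOn {S : Set (Ideal R)} (hne : S.Nonempty)
    (hd : DirectedOn (· ≤ ·) S) (hS : ∀ P ∈ S, P.IsPrime) : (sSup S).IsPrime := by
  constructor
  · intro e
    obtain ⟨P, hP, h1⟩ := (Submodule.mem_sSup_of_directed hne hd).1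
      (e ▸ Submodule.mem_top : (1 : R) ∈ sSup S)
    exact (hS P hP).one_notMem h1
  · intro x y hxy
    obtain ⟨P, hP, h⟩ := (Submodule.mem_sSup_of_directed hne hd).1 hxy
    exact ((hS P hP).mem_or_mem h).imp (fun h => le_sSup hP h) fun h => le_sSup hP h

/-- In a valuation domain, a prime properly contained in the radical of a primary ideal `Q` is
contained in `Q`. -/
theorem IsValuativeAt.le_of_isPrimary {P P' Q : Ideal R} (hP : IsValuativeAt P)
    (hQ : Q.IsPrimary) (hQP : Q.radical = P) (hP' : P'.IsPrime) (h : P' < P) : P' ≤ Q := by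
  intro y hy
  obtain ⟨z, hz, hzP'⟩ : ∃ z ∈ Q, z ∉ P' := by
    refine SetLike.not_le_iff_exists.1 fun hle => h.not_ge ?_
    exact hQP ▸ hP'.radical_le_iff.2 hle
  obtain ⟨s, hs, hd | hd⟩ := hP z y
  · have hsy : y * s ∈ Q := mul_comm s y ▸ Ideal.mem_of_dvd _ hd hz
    exact ((Ideal.isPrimary_iff.1 hQ).2 hsy).resolve_right (hQP ▸ hs)
  · exact ((hP'.mem_or_mem (Ideal.mem_of_dvd _ hd hy)).elim (fun h' => hs (h.le h')) hzP').elim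

variable [IsDomain R]

/-- A branched prime is not the union of a chain of strictly smaller primes, since these are all
contained in a primary ideal. -/
theorem accTPrimes_of_isBranched (hR : IsPVMD R K)
    (h : ∀ P : Ideal R, IsTPrime K P → IsBranched P) : ACCTPrimes R K := by
  refine wellFoundedGT_subtype_of_chain fun f hf => ?_
  have hne := Set.range_nonempty f
  have hd := directedOn_range_orderHom f
  have hP : IsTPrime K (sSup (Set.range f)) :=
    ⟨isPrime_sSup_of_directedOn hne hd (by rintro _ ⟨n, rfl⟩; exact (hf n).1),
      isTIdeal_sSup hne hd (by rintro _ ⟨n, rfl⟩; exact (hf n).2)⟩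
  obtain ⟨Q, hQ, hQP, hne⟩ := h _ hP
  have hle : ∀ n, f n ≤ sSup (Set.range f) := fun n => le_sSup (Set.mem_range_self n)
  by_cases hst : ∃ n, f n = sSup (Set.range f)
  · obtain ⟨n, hn⟩ := hst
    exact ⟨n, fun m => hn ▸ hle m⟩
  push Not at hst
  refine (hne (le_antisymm (hQP ▸ Ideal.le_radical) (sSup_le ?_))).elim
  rintro _ ⟨n, rfl⟩
  exact (hR.isValuativeAt_of_isTPrime hP).le_of_isPrimary hQ hQP (hf n).1 ((hle n).lt_of_ne (hst n))

variable [FaithfulSMul R K]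

/-- By the chain condition there is a largest prime strictly below `P`; take for `a` an element of
`P` outside of it. -/
theorem exists_mem_minimalPrimes_span_singleton (hR : IsPVMD R K) (hacc : ACCTPrimes R K)
    {P : Ideal R} (hP : IsTPrime K P) : ∃ a : R, a ≠ 0 ∧ P ∈ (Ideal.span {a}).minimalPrimes := by
  have hV := hR.isValuativeAt_of_isTPrime hP
  have hred : ∀ a ∈ P, (∀ Q : Ideal R, IsTPrime K Q → Q < P → a ∉ Q) → a ≠ 0 →
      ∃ a : R, a ≠ 0 ∧ P ∈ (Ideal.span {a}).minimalPrimes := by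
    refine fun a ha h ha0 => ⟨a, ha0, ⟨hP.1, (Ideal.span_singleton_le_iff_mem _).2 ha⟩, ?_⟩
    rintro Q ⟨hQ, haQ⟩ hQP
    by_contra hPQ
    have haQ' : a ∈ Q := (Ideal.span_singleton_le_iff_mem _).1 haQ
    exact h Q ((hV.anti hQP).isTPrime hQ fun e => ha0 (by simpa [e] using haQ'))
      (lt_of_le_not_ge hQP hPQ) haQ'
  by_cases hne : ∃ Q : Ideal R, IsTPrime K Q ∧ Q < P
  · obtain ⟨Q, hQ, hQP⟩ := hne
    have : WellFoundedGT {P : Ideal R // IsTPrime K P} := hacc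
    obtain ⟨⟨P₀, hP₀⟩, hP₀P, hmax⟩ := WellFounded.has_min (wellFounded_gt
      (α := {P : Ideal R // IsTPrime K P})) {Q | Q.1 < P} ⟨⟨Q, hQ⟩, hQP⟩
    obtain ⟨a, ha, haP₀⟩ := SetLike.exists_of_lt (show P₀ < P from hP₀P)
    refine hred a ha (fun Q hQ hQP haQ => ?_) fun e => haP₀ (e ▸ P₀.zero_mem)
    have hle : P₀ ≤ Q := (hV.le_total hP₀.1 hQ.1 (le_of_lt hP₀P) hQP.le).resolve_right
      fun h => haP₀ (h haQ)
    exact hmax ⟨Q, hQ⟩ hQP (lt_of_le_not_ge hle fun h => haP₀ (h haQ))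
  · push Not at hne
    obtain ⟨a, ha, ha0⟩ := Submodule.exists_mem_ne_zero_of_ne_bot hP.2.1
    exact hred a ha (fun Q hQ hQP => (hne Q hQ hQP).elim) ha0

/-- If `P` is minimal over `a R`, then `a² R_P ∩ R` is a `P`-primary ideal different from `P`. -/
theorem ACCTPrimes.isBranched (hR : IsPVMD R K) (hacc : ACCTPrimes R K)
    {P : Ideal R} (hP : IsTPrime K P) : IsBranched P := by
  obtain ⟨a, ha0, hPa⟩ := exists_mem_minimalPrimes_span_singleton hR hacc hP
  have hp := hP.1
  have haP : a ∈ P := (Ideal.span_singleton_le_iff_mem _).1 hPa.1.2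
  let Q : Ideal R :=
    { carrier := {r | ∃ s ∉ P, a ^ 2 ∣ s * r}
      zero_mem' := ⟨1, hp.one_notMem, by simp⟩
      add_mem' := by
        rintro x y ⟨s, hs, hx⟩ ⟨t, ht, hy⟩
        refine ⟨s * t, fun h => (hp.mem_or_mem h).elim hs ht, ?_⟩
        rw [show s * t * (x + y) = s * x * t + t * y * s by ring]
        exact dvd_add (dvd_mul_of_dvd_left hx _) (dvd_mul_of_dvd_left hy _)
      smul_mem' := by
        rintro c x ⟨s, hs, hx⟩
        refine ⟨s, hs, ?_⟩
        rw [smul_eq_mul, mul_left_comm]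
        exact dvd_mul_of_dvd_right hx c }
  have hQ : ∀ r, r ∈ Q ↔ ∃ s ∉ P, a ^ 2 ∣ s * r := fun r => Iff.rfl
  have hQP : Q ≤ P := fun r ⟨s, hs, h⟩ =>
    (hp.mem_or_mem (Ideal.mem_of_dvd _ h (P.pow_mem_of_mem haP 2 two_pos))).resolve_left hs
  have hrad : Q.radical = P := by
    refine le_antisymm (hp.radical_le_iff.2 hQP) fun r hr => ?_
    obtain ⟨s, hs, n, h⟩ := exists_mul_pow_mem_of_mem_minimalPrimes hPa hr
    refine ⟨n * 2, s ^ 2, fun h => hs (hp.mem_of_pow_mem 2 h), ?_⟩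
    rw [pow_mul, ← mul_pow]
    exact pow_dvd_pow_of_dvd (Ideal.mem_span_singleton.1 h) 2
  refine ⟨Q, Ideal.isPrimary_iff.2 ⟨fun e => hp.ne_top (top_le_iff.1 (e ▸ hQP)), ?_⟩, hrad, ?_⟩
  · rintro x y ⟨s, hs, h⟩
    rw [hrad]
    refine or_iff_not_imp_right.2 fun hy => ⟨s * y, fun h => (hp.mem_or_mem h).elim hs hy, ?_⟩
    rwa [mul_assoc, mul_comm y]
  · intro e
    obtain ⟨s, hs, h⟩ := (hQ a).1 (e ▸ haP)
    rw [pow_two] at h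
    exact hs (Ideal.mem_of_dvd _ ((mul_dvd_mul_iff_right ha0).1 h) haP)

end Branched

/-! ### Intersections of localizations -/

section LocalizationInter

variable {R : Type*} (K : Type*) [CommRing R] [Field K] [Algebra R K]

/-- The overring `⋂ R_P` of `R`, where `P` ranges over a set of prime ideals; it is `K` if this set
is empty. -/
def localizationInter (Λ : Set (Ideal R)) (hΛ : ∀ P ∈ Λ, P.IsPrime) : Subalgebra R K where
  carrier := {x | ∀ P ∈ Λ, x ∈ localizationAt K P}
  mul_mem' := by
    intro x y hx hy P hP
    obtain ⟨a, s, hs, ha⟩ := hx P hP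
    obtain ⟨b, t, ht, hb⟩ := hy P hP
    refine ⟨a * b, s * t, fun h => ((hΛ P hP).mem_or_mem h).elim hs ht, ?_⟩
    rw [map_mul, map_mul, ← ha, ← hb]
    ring
  add_mem' := by
    intro x y hx hy P hP
    obtain ⟨a, s, hs, ha⟩ := hx P hP
    obtain ⟨b, t, ht, hb⟩ := hy P hP
    refine ⟨a * t + b * s, s * t, fun h => ((hΛ P hP).mem_or_mem h).elim hs ht, ?_⟩
    rw [map_mul, map_add, map_mul, map_mul, ← ha, ← hb]
    ring
  algebraMap_mem' := fun r P hP => algebraMap_mem_localizationAt (hΛ P hP) r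

variable {K}

theorem mem_localizationInter {Λ : Set (Ideal R)} {hΛ : ∀ P ∈ Λ, P.IsPrime} {x : K} :
    x ∈ localizationInter K Λ hΛ ↔ ∀ P ∈ Λ, x ∈ localizationAt K P :=
  Iff.rfl

end LocalizationInter

/-! ### `t`-linked overrings -/

section Overrings

variable {R K : Type*} [CommRing R] [IsDomain R] [Field K] [Algebra R K] [IsFractionRing R K]

theorem comap_ne_bot {T : Subalgebra R K} {N : Ideal T} (hN : N ≠ ⊥) :
    N.comap (algebraMap R T) ≠ ⊥ := by
  obtain ⟨n, hn, hn0⟩ := Submodule.exists_mem_ne_zero_of_ne_bot hN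
  obtain ⟨a, b, hb, hab⟩ := IsFractionRing.div_surjective R (n : K)
  have hb0 : algebraMap R K b ≠ 0 := IsFractionRing.to_map_ne_zero_of_mem_nonZeroDivisors hb
  have e : algebraMap R T a = n * algebraMap R T b :=
    Subtype.ext (show algebraMap R K a = n * algebraMap R K b by rw [← hab, div_mul_cancel₀ _ hb0])
  have ha : a ∈ N.comap (algebraMap R T) := by
    rw [Ideal.mem_comap, e]
    exact N.mul_mem_right _ hn
  intro h
  rw [h, Ideal.mem_bot] at ha
  refine hn0 (Subtype.ext ?_)
  rw [← hab, ha]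
  simp

/-- `t`-primes of a `t`-linked overring contract to `t`-primes: if the contraction had `t`-closure
`R`, it would contain a finitely generated ideal `J` with `J⁻¹ = R`, whence `(J T)⁻¹ = T`. -/
theorem IsTLinked.isTPrime_comap (hR : IsPVMD R K) {T : Subalgebra R K} (hT : IsTLinked K T)
    {N : Ideal T} (hN : IsTPrime K N) : IsTPrime K (N.comap (algebraMap R T)) := by
  have hNp := hN.1
  have h0 := comap_ne_bot hN.2.1
  obtain ⟨M, hM, hle⟩ : ∃ M : Ideal R, IsMaximalTIdeal K M ∧ N.comap (algebraMap R T) ≤ M := by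
    by_contra! hc
    obtain ⟨J, ⟨hJ0, hJ, hJN⟩, h1⟩ := exists_fg_one_mem_vClosure h0 hc
    refine hN.one_notMem_vClosure (J := J.map (algebraMap R T)) ?_ (hJ.map _)
      (Ideal.map_le_iff_le_comap.2 hJN) (inverse_eq_one_iff.1 (hT J hJ (inverse_eq_one_iff.2 h1)))
    rwa [Ne, Ideal.map_eq_bot_iff_of_injective (FaithfulSMul.algebraMap_injective R T)]
  exact (hR.isValuativeAt hM hle).isTPrime (hNp.comap _) h0

/-- `T_N = R_{N ∩ R}` for each `t`-prime `N` of a `t`-linked overring `T`, since `T_N` dominates the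
valuation domain `R_{N ∩ R}`. -/
theorem IsTLinked.localizationAt_comap (hR : IsPVMD R K) {T : Subalgebra R K} (hT : IsTLinked K T)
    {N : Ideal T} (hN : IsTPrime K N) :
    localizationAt K (N.comap (algebraMap R T)) = localizationAt K N := by
  have hNp := hN.1
  refine Set.Subset.antisymm ?_ ?_
  · rintro x ⟨a, s, hs, e⟩
    exact ⟨algebraMap R T a, algebraMap R T s, hs, e⟩
  · rintro y ⟨a, t, ht, e⟩
    obtain ⟨c, d, hd, rfl⟩ := IsFractionRing.div_surjective R y
    have hd0 : algebraMap R K d ≠ 0 := IsFractionRing.to_map_ne_zero_of_mem_nonZeroDivisors hd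
    obtain ⟨u, hu, ⟨x, h⟩ | ⟨x, h⟩⟩ :=
      hR.isValuativeAt_of_isTPrime (hT.isTPrime_comap hR hN) d c
    · refine ⟨x, u, hu, ?_⟩
      rw [div_mul_eq_mul_div, ← map_mul, mul_comm c, h, map_mul, mul_div_cancel_left₀ _ hd0]
    · -- Here `c / d = u / x`, and the assumption `c / d = a / t` forces `x ∉ N`.
      have h' : algebraMap R K u * algebraMap R K d = algebraMap R K c * algebraMap R K x := by
        rw [← map_mul, h, map_mul]
      refine ⟨u, x, fun hx => ?_, ?_⟩
      · have hut : algebraMap R T u * t = a * algebraMap R T x := by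
          refine Subtype.ext (show algebraMap R K u * (t : K) = a * algebraMap R K x from ?_)
          have e' : algebraMap R K c / algebraMap R K d * (t : K) = a := e
          rw [← e', ← mul_left_inj' hd0]
          field_simp
          linear_combination (t : K) * h'
        have : algebraMap R T u * t ∈ N := hut ▸ N.mul_mem_left a hx
        exact (hNp.mem_or_mem this).elim hu ht
      · rw [div_mul_eq_mul_div, ← h', mul_div_cancel_right₀ _ hd0]

theorem isTLinked_localizationInter (hR : IsPVMD R K) {Λ : Set (Ideal R)}
    (hΛ : ∀ P ∈ Λ, IsTPrime K P) :
    IsTLinked K (localizationInter K Λ fun P hP => (hΛ P hP).1) := by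
  intro I hI h1
  rw [inverse_eq_one_iff, mem_vClosure]
  intro y hy
  suffices h : y ∈ localizationInter K Λ fun P hP => (hΛ P hP).1 from
    Submodule.mem_one.2 ⟨⟨y, h⟩, by rw [map_one, one_mul]; rfl⟩
  rw [mem_localizationInter]
  intro P hP
  have hIP : ¬ I ≤ P := fun hIP => by
    obtain ⟨z, hz, hzP⟩ := (hR.isValuativeAt_of_isTPrime (hΛ P hP)).exists_mem_inverse_notMem
      (K := K) (hΛ P hP).1 (hΛ P hP).2.1 hI hIP
    obtain ⟨r, rfl⟩ := Submodule.mem_one.1 (h1 ▸ hz)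
    exact hzP (algebraMap_mem_localizationAt (hΛ P hP).1 r)
  obtain ⟨i, hi, hiP⟩ := SetLike.not_le_iff_exists.1 hIP
  obtain ⟨t, ht⟩ := Submodule.mem_one.1 (mem_inverse.1 hy _ (Ideal.mem_map_of_mem _ hi))
  obtain ⟨a, s, hs, e⟩ := mem_localizationInter.1 t.2 P hP
  refine ⟨a, i * s, fun h => ((hΛ P hP).1.mem_or_mem h).elim hiP hs, ?_⟩
  rw [← e, map_mul, ← mul_assoc]
  exact congrArg (· * _) ht.symm

/-- Each `P ∈ Λ` is contained in the contraction of a maximal `t`-ideal of `T = ⋂ R_P`, namely of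
one containing `P R_P ∩ T`. -/
theorem exists_isMaximalTIdeal_le_comap (hR : IsPVMD R K) {Λ : Set (Ideal R)}
    (hΛ : ∀ P ∈ Λ, P.IsPrime) {P : Ideal R} (hPΛ : P ∈ Λ) (hP : IsTPrime K P) :
    ∃ N : Ideal (localizationInter K Λ hΛ), IsMaximalTIdeal K N ∧
      P ≤ N.comap (algebraMap R (localizationInter K Λ hΛ)) := by
  have hp := hP.1
  have hinj := FaithfulSMul.algebraMap_injective R K
  -- The ideal `P R_P ∩ T`.
  let N : Ideal (localizationInter K Λ hΛ) :=
    { carrier := {x | ∃ a ∈ P, ∃ s ∉ P, (x : K) * algebraMap R K s = algebraMap R K a}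
      zero_mem' := ⟨0, P.zero_mem, 1, hp.one_notMem, by simp⟩
      add_mem' := by
        rintro x y ⟨a, ha, s, hs, hx⟩ ⟨b, hb, t, ht, hy⟩
        refine ⟨a * t + b * s, P.add_mem (P.mul_mem_right _ ha) (P.mul_mem_right _ hb), s * t,
          fun h => (hp.mem_or_mem h).elim hs ht, ?_⟩
        rw [Subalgebra.coe_add, map_mul, map_add, map_mul, map_mul, ← hx, ← hy]
        ring
      smul_mem' := by
        rintro c x ⟨a, ha, s, hs, hx⟩
        obtain ⟨b, t, ht, hc⟩ := mem_localizationInter.1 c.2 P hPΛ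
        refine ⟨b * a, P.mul_mem_left _ ha, t * s, fun h => (hp.mem_or_mem h).elim ht hs, ?_⟩
        rw [smul_eq_mul, Subalgebra.coe_mul, map_mul, map_mul, ← hx, ← hc]
        ring }
  have hmem : ∀ {x : localizationInter K Λ hΛ} {a s : R}, s ∉ P →
      (x : K) * algebraMap R K s = algebraMap R K a → (x ∈ N ↔ a ∈ P) := by
    refine fun {x a s} hs e => ⟨?_, fun ha => ⟨a, ha, s, hs, e⟩⟩
    rintro ⟨b, hb, t, ht, e'⟩
    have : a * t = b * s := hinj (by rw [map_mul, map_mul, ← e, ← e']; ring)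
    exact (hp.mem_or_mem (this ▸ P.mul_mem_right s hb : a * t ∈ P)).resolve_right ht
  have hR' : ∀ r : R, algebraMap R (localizationInter K Λ hΛ) r ∈ N ↔ r ∈ P := fun r =>
    hmem hp.one_notMem (by rw [map_one, mul_one]; rfl)
  have hNp : N.IsPrime := by
    refine ⟨fun e => ?_, fun {x y} hxy => ?_⟩
    · exact hp.one_notMem ((hR' 1).1 (e ▸ Submodule.mem_top))
    · obtain ⟨a, s, hs, hx⟩ := mem_localizationInter.1 x.2 P hPΛ
      obtain ⟨b, t, ht, hy⟩ := mem_localizationInter.1 y.2 P hPΛ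
      rw [hmem hs hx, hmem ht hy]
      refine hp.mem_or_mem ((hmem (s := s * t) (fun h => (hp.mem_or_mem h).elim hs ht) ?_).1 hxy)
      rw [Subalgebra.coe_mul, map_mul, map_mul, ← hx, ← hy]
      ring
  have hN0 : N ≠ ⊥ := by
    obtain ⟨m, hm, hm0⟩ := Submodule.exists_mem_ne_zero_of_ne_bot hP.2.1
    intro e
    have := (hR' m).2 hm
    rw [e, Ideal.mem_bot] at this
    exact hm0 (FaithfulSMul.algebraMap_injective R (localizationInter K Λ hΛ)
      (this.trans (map_zero _).symm))
  have hV : IsValuativeAt N := by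
    have key : ∀ {x y : localizationInter K Λ hΛ} {a b s t u : R}, s ∉ P → t ∉ P →
        (x : K) * algebraMap R K s = algebraMap R K a →
        (y : K) * algebraMap R K t = algebraMap R K b →
        a * t ∣ u * (b * s) → x ∣ algebraMap R _ u * y := by
      rintro x y a b s t u hs ht hx hy ⟨c, hc⟩
      have hs0 : algebraMap R K s ≠ 0 := by
        simpa using hinj.ne fun e : s = 0 => hs (e ▸ P.zero_mem)
      have ht0 : algebraMap R K t ≠ 0 := by
        simpa using hinj.ne fun e : t = 0 => ht (e ▸ P.zero_mem)
      have hc' := congrArg (algebraMap R K) hc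
      simp only [map_mul, ← hx, ← hy] at hc'
      refine ⟨algebraMap R _ c, Subtype.ext ?_⟩
      refine mul_right_cancel₀ (mul_ne_zero hs0 ht0) ?_
      change algebraMap R K u * y * _ = x * algebraMap R K c * _
      linear_combination hc'
    intro x y
    obtain ⟨a, s, hs, hx⟩ := mem_localizationInter.1 x.2 P hPΛ
    obtain ⟨b, t, ht, hy⟩ := mem_localizationInter.1 y.2 P hPΛ
    obtain ⟨u, hu, h⟩ := hR.isValuativeAt_of_isTPrime hP (a * t) (b * s)
    exact ⟨algebraMap R _ u, fun h => hu ((hR' u).1 h), h.imp (key hs ht hx hy) (key ht hs hy hx)⟩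
  obtain ⟨M, hM, hNM⟩ := (hV.isTPrime (K := K) hNp hN0).exists_le_isMaximalTIdeal
  exact ⟨M, hM, fun r hr => hNM ((hR' r).2 hr)⟩

end Overrings

/-! ### Denominator ideals -/

section FractionIdeals

variable {R K : Type*} [CommRing R] [IsDomain R] [Field K] [Algebra R K] [IsFractionRing R K]

/-- The denominator ideal of `x = a / b` is, up to `t`-closure, finitely generated. To see this,
consider the elements `r` with `r a ∈ b R` and those with `r b ∈ a R`. As either `x` or `x⁻¹` is in
`R_M`, they lie in no common maximal `t`-ideal `M`, so that finitely many of them have this property.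
Multiplying the elements of the second kind by `x⁻¹` turns these into denominators of `x`. -/
theorem IsPVMD.exists_fg_mem_inverse (hR : IsPVMD R K) (x : K) :
    ∃ J : Ideal R, J.FG ∧ x ∈ inverse K J ∧
      ∀ P : Ideal R, IsTPrime K P → x ∈ localizationAt K P → ¬ J ≤ P := by
  obtain ⟨a, b, hb, rfl⟩ := IsFractionRing.div_surjective R x
  have hinj := FaithfulSMul.algebraMap_injective R K
  have hb0 : b ≠ 0 := nonZeroDivisors.ne_zero hb
  have hb0' : algebraMap R K b ≠ 0 := IsFractionRing.to_map_ne_zero_of_mem_nonZeroDivisors hb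
  rcases eq_or_ne a 0 with rfl | ha0
  · exact ⟨⊤, ⟨{1}, by simp⟩, by simp, fun P hP _ h => hP.1.ne_top (top_le_iff.1 h)⟩
  let S : Set R := {r | b ∣ r * a ∨ a ∣ r * b}
  have hbS : b ∈ S := Or.inl (dvd_mul_right b a)
  obtain ⟨L, ⟨hL0, hL, hLS⟩, h1⟩ := exists_fg_one_mem_vClosure (K := K) (I := Ideal.span S)
    (fun e => hb0 (Ideal.span_eq_bot.1 e b hbS)) fun M hM hle => by
      obtain ⟨s, hs, h⟩ := hR.isValuativeAt hM le_rfl b a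
      exact hs (hle (Ideal.subset_span h))
  obtain ⟨G, hG⟩ := hL
  obtain ⟨F, hFS, hGF⟩ := Submodule.subset_span_finite_of_subset_span (s := S) (t := G)
    (fun g hg => hLS (hG ▸ Submodule.subset_span hg))
  have hLF : L ≤ Ideal.span (F : Set R) := hG ▸ Submodule.span_le.2 hGF
  have hpart : ∀ f ∈ S, ∃ r, b ∣ r * a ∧ (r = f ∨ f * b = a * r) := by
    rintro f (h | ⟨r, hr⟩)
    · exact ⟨f, h, Or.inl rfl⟩
    · exact ⟨r, ⟨f, by rw [mul_comm r, ← hr, mul_comm]⟩, Or.inr hr⟩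
  choose! g hg1 hg2 using hpart
  refine ⟨Ideal.span (g '' F), Submodule.fg_span (F.finite_toSet.image g), ?_, ?_⟩
  · have hle : Ideal.span (g '' F) ≤ Submodule.comap (LinearMap.mulRight R a) (Ideal.span {b}) := by
      rw [Ideal.span_le]
      rintro _ ⟨f, hf, rfl⟩
      exact Ideal.mem_span_singleton.2 (hg1 f (hFS hf))
    refine mem_inverse.2 fun r hr => ?_
    obtain ⟨c, hc⟩ := Ideal.mem_span_singleton.1 (hle hr)
    have hc : r * a = b * c := hc
    refine Submodule.mem_one.2 ⟨c, ?_⟩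
    rw [div_mul_eq_mul_div, ← map_mul, mul_comm a, hc, map_mul, mul_div_cancel_left₀ _ hb0']
  · rintro P hP ⟨t, s, hs, e⟩ hle
    obtain ⟨f, hf, hfP⟩ : ∃ f ∈ F, f ∉ P := by
      by_contra! hc
      exact hP.one_notMem_vClosure hL0 ⟨G, hG⟩ (hLF.trans (Ideal.span_le.2 hc)) h1
    have hgP : g f ∈ P := hle (Ideal.subset_span ⟨f, hf, rfl⟩)
    rcases hg2 f (hFS hf) with h | h
    · exact hfP (h ▸ hgP)
    · have hst : s * a = t * b := by
        rw [div_mul_eq_mul_div, div_eq_iff hb0', ← map_mul, ← map_mul] at e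
        rw [mul_comm s, hinj e]
      have hfs : f * s = g f * t := by
        refine mul_right_cancel₀ (mul_ne_zero ha0 hb0) ?_
        linear_combination s * a * h + a * g f * hst
      exact (hP.1.mem_or_mem (hfs ▸ P.mul_mem_right t hgP : f * s ∈ P)).elim hfP hs

end FractionIdeals

/-! ### The `t#`-property -/

section TSharpProperty

variable {R K : Type*} [CommRing R] [Field K] [Algebra R K]

/-- In a `t#`-domain, no maximal `t`-ideal may be omitted from `R = ⋂ R_M`. -/
theorem IsTSharp.exists_notMem_localizationAt (h : IsTSharp R K) {M : Ideal R}
    (hM : IsMaximalTIdeal K M) : ∃ x : K, x ∉ localizationAt K M ∧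
      ∀ M' : Ideal R, IsMaximalTIdeal K M' → M' ≠ M → x ∈ localizationAt K M' := by
  by_contra! hc
  refine h {M | IsMaximalTIdeal K M} ({M | IsMaximalTIdeal K M} \ {M}) subset_rfl
    Set.sdiff_subset (fun e => ?_) (Set.Subset.antisymm ?_ ?_)
  · exact ((Set.ext_iff.1 e M).1 hM).2 rfl
  · exact Set.biInter_mono Set.sdiff_subset fun _ _ => subset_rfl
  · intro x hx
    have hx' : ∀ M' : Ideal R, IsMaximalTIdeal K M' → M' ≠ M → x ∈ localizationAt K M' :=
      fun M' hM' hne => Set.mem_iInter₂.1 hx M' ⟨hM', hne⟩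
    refine Set.mem_iInter₂.2 fun M' hM' => ?_
    by_cases hne : M' = M
    · subst hne
      by_contra hxM
      obtain ⟨M'', h1, h2, h3⟩ := hc x hxM
      exact h3 (hx' M'' h1 h2)
    · exact hx' M' hM' hne

variable [IsDomain R] [IsFractionRing R K]

/-- Distinct maximal `t`-ideals of `T` contract to incomparable primes of `R`. Given a maximal
`t`-ideal `N` in `S₁` but not in `S₂`, the hypothesis, applied to `Λ = {N' ∩ R | N' ∈ S₂}`, gives
a finitely generated `J ⊆ N ∩ R` not contained in any `N' ∈ S₂`, and then `J⁻¹` is contained in all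
`T_{N'}` but not in `T_N`. -/
theorem isTSharp_of_isVFiniteSystem (hR : IsPVMD R K)
    (h : ∀ Λ : Set (Ideal R), (∀ P ∈ Λ, IsTPrime K P) → IsVFiniteSystem K (tSystem K Λ))
    {T : Subalgebra R K} (hT : IsTLinked K T) : IsTSharp T K := by
  have key : ∀ S₁ S₂ : Set (Ideal T), S₁ ⊆ {M | IsMaximalTIdeal K M} →
      S₂ ⊆ {M | IsMaximalTIdeal K M} →
      (⋂ M ∈ S₂, localizationAt K M) ⊆ (⋂ M ∈ S₁, localizationAt K M) → S₁ ⊆ S₂ := by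
    intro S₁ S₂ h₁ h₂ hS N hN
    by_contra hNS
    have hNt : IsTPrime K N := (h₁ hN).isTPrime
    have hP := hT.isTPrime_comap hR hNt
    have hΛ : ∀ P ∈ (Ideal.comap (algebraMap R T)) '' S₂, IsTPrime K P := by
      rintro _ ⟨N', hN', rfl⟩
      exact hT.isTPrime_comap hR (h₂ hN').isTPrime
    obtain ⟨J, -, hJ, hJN, hJΛ⟩ := (isVFiniteSystem_tSystem_iff hΛ).1 (h _ hΛ) _ hP.2 <| by
      rintro _ ⟨N', hN', rfl⟩ hle
      have hN't : IsTPrime K N' := (h₂ hN').isTPrime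
      have hloc := localizationAt_anti (K := K) hle
      rw [hT.localizationAt_comap hR hNt, hT.localizationAt_comap hR hN't] at hloc
      have hNN' : N ≤ N' := fun x hx => by
        by_contra hxN'
        have hx0 : (x : K) ≠ 0 := fun e => hxN' ((Subtype.ext e : x = 0) ▸ N'.zero_mem)
        obtain ⟨a, s, hs, e⟩ := hloc (a := (x : K)⁻¹)
          ⟨1, x, hxN', by rw [map_one]; exact inv_mul_cancel₀ hx0⟩
        have : s = x * a := Subtype.ext (by
          change (s : K) = x * a
          have e : (x : K)⁻¹ * s = a := e
          rw [← e, mul_inv_cancel_left₀ hx0])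
        exact hs (this ▸ N.mul_mem_right a hx)
      exact hNS ((le_antisymm hNN' ((h₁ hN).2 (h₂ hN').1 hNN')) ▸ hN')
    obtain ⟨y, hy, hyN⟩ := (hR.isValuativeAt_of_isTPrime hP).exists_mem_inverse_notMem
      (K := K) hP.1 hP.2.1 hJ hJN
    rw [hT.localizationAt_comap hR hNt] at hyN
    refine hyN (Set.mem_iInter₂.1 (hS (Set.mem_iInter₂.2 fun N' hN' => ?_)) N hN)
    rw [← hT.localizationAt_comap hR (h₂ hN').isTPrime]
    exact mem_localizationAt_of_mem_inverse (hJΛ _ ⟨N', hN', rfl⟩) hy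
  exact fun S₁ S₂ h₁ h₂ hne e =>
    hne (Set.Subset.antisymm (key S₁ S₂ h₁ h₂ e.ge) (key S₂ S₁ h₂ h₁ e.le))

/-- If `T = ⋂_{P ∈ Λ} R_P` is a `t#`-domain, where `Λ` is an antichain of `t`-primes, then each
maximal `t`-ideal `N` of `T` lies over a member of `Λ`. Indeed, let `x` be in `T_{N'}` for all `N'`
other than `N`, but not in `T_N`. If `N ∩ R` did not contain a member of `Λ`, then all members of
`Λ` would lie below other maximal `t`-ideals, so that `x ∈ T`. If `N ∩ R` properly contained
`P ∈ Λ`, then adjoining an element of `(N ∩ R) \ P` to a finitely generated ideal of denominators of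
`x` would give an ideal `J ⊆ N ∩ R` contained in no member of `Λ`, and `J⁻¹ ⊆ T ⊆ R_{N ∩ R}`,
which is impossible. -/
theorem comap_mem_of_isTSharp (hR : IsPVMD R K) {Λ : Set (Ideal R)}
    (hΛ : ∀ P ∈ Λ, IsTPrime K P) (hanti : IsAntichain (· ≤ ·) Λ)
    {T : Subalgebra R K} (hTΛ : T = localizationInter K Λ fun P hP => (hΛ P hP).1)
    (hT : IsTSharp T K) {N : Ideal T} (hN : IsMaximalTIdeal K N) :
    N.comap (algebraMap R T) ∈ Λ := by
  have hTl : IsTLinked K T := hTΛ ▸ isTLinked_localizationInter hR hΛ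
  have hTmem : ∀ y, y ∈ T ↔ ∀ P ∈ Λ, y ∈ localizationAt K P := fun y => hTΛ ▸ Iff.rfl
  have hmax : ∀ P ∈ Λ, ∃ N : Ideal T, IsMaximalTIdeal K N ∧ P ≤ N.comap (algebraMap R T) := by
    subst hTΛ
    exact fun P hP => exists_isMaximalTIdeal_le_comap hR _ hP (hΛ P hP)
  have hQ := hTl.isTPrime_comap hR hN.isTPrime
  obtain ⟨x, hxN, hx⟩ := hT.exists_notMem_localizationAt hN
  have hxP : ∀ P ∈ Λ, ¬ P ≤ N.comap (algebraMap R T) → x ∈ localizationAt K P := by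
    intro P hP hPN
    obtain ⟨N', hN', hPN'⟩ := hmax P hP
    refine localizationAt_anti hPN' ?_
    rw [hTl.localizationAt_comap hR hN'.isTPrime]
    exact hx N' hN' fun e => hPN (e ▸ hPN')
  have hTN : ∀ y ∈ T, y ∈ localizationAt K N := fun y hy =>
    algebraMap_mem_localizationAt (R := T) (K := K) hN.isPrime ⟨y, hy⟩
  obtain ⟨P, hP, hPN⟩ : ∃ P ∈ Λ, P ≤ N.comap (algebraMap R T) := by
    by_contra! hc
    exact hxN (hTN x ((hTmem _).2 fun P hP => hxP P hP (hc P hP)))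
  suffices h : N.comap (algebraMap R T) ≤ P from le_antisymm hPN h ▸ hP
  by_contra hNP
  obtain ⟨q, hq, hqP⟩ := SetLike.not_le_iff_exists.1 hNP
  obtain ⟨J, hJ, hxJ, hJP⟩ := hR.exists_fg_mem_inverse x
  rw [← hTl.localizationAt_comap hR hN.isTPrime] at hxN hTN
  have hJN : J ≤ N.comap (algebraMap R T) := by
    by_contra hJN
    exact hxN (mem_localizationAt_of_mem_inverse hJN hxJ)
  obtain ⟨y, hy, hyN⟩ := (hR.isValuativeAt_of_isTPrime hQ).exists_mem_inverse_notMem (K := K)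
    hQ.1 hQ.2.1 (J := J ⊔ Ideal.span {q}) (Submodule.FG.sup hJ (Submodule.fg_span_singleton q))
    (sup_le hJN ((Ideal.span_singleton_le_iff_mem _).2 hq))
  refine hyN (hTN y ((hTmem _).2 fun P' hP' =>
    mem_localizationAt_of_mem_inverse (fun hle => ?_) hy))
  rcases eq_or_ne P' P with rfl | hne
  · exact hqP (hle (Ideal.mem_sup_right (Ideal.mem_span_singleton_self q)))
  · refine hJP P' (hΛ P' hP') (hxP P' hP' fun hP'N => ?_) (le_sup_left.trans hle)
    exact ((hR.isValuativeAt_of_isTPrime hQ).le_total (hΛ P' hP').1 (hΛ P hP).1 hP'N hPN).elim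
      (hanti hP' hP hne) (hanti hP hP' hne.symm)

/-- Let `I` be contained in no member of the antichain `Λ`. Then `I T` is contained in no maximal
`t`-ideal of `T = ⋂_{P ∈ Λ} R_P`, and finitely many elements of `I` suffice for this. -/
theorem isVFiniteSystem_of_isTSharp (hR : IsPVMD R K)
    (h : ∀ T : Subalgebra R K, IsTLinked K T → IsTSharp T K) {Λ : Set (Ideal R)}
    (hΛ : ∀ P ∈ Λ, IsTPrime K P) (hanti : IsAntichain (· ≤ ·) Λ) :
    IsVFiniteSystem K (tSystem K Λ) := by
  refine (isVFiniteSystem_tSystem_iff hΛ).2 fun I hI hIΛ => ?_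
  set T := localizationInter K Λ fun P hP => (hΛ P hP).1
  have hTl : IsTLinked K T := isTLinked_localizationInter hR hΛ
  have hmem : ∀ N : Ideal T, IsMaximalTIdeal K N → N.comap (algebraMap R T) ∈ Λ := fun N hN =>
    comap_mem_of_isTSharp hR hΛ hanti rfl (h T hTl) hN
  have hIT0 : I.map (algebraMap R T) ≠ ⊥ := by
    rw [Ne, Ideal.map_eq_bot_iff_of_injective (FaithfulSMul.algebraMap_injective R T)]
    exact hI.1
  obtain ⟨L, ⟨hL0, hL, hLI⟩, h1⟩ := exists_fg_one_mem_vClosure (K := K) hIT0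
    fun N hN hle => hIΛ _ (hmem N hN) (Ideal.map_le_iff_le_comap.1 hle)
  obtain ⟨G, hG⟩ := hL
  obtain ⟨F, hFI, hGF⟩ := Submodule.subset_span_finite_of_subset_span
    (s := algebraMap R T '' I) (t := G) (fun g hg => hLI (hG ▸ Submodule.subset_span hg))
  have hLF : L ≤ Ideal.span (F : Set T) := hG ▸ Submodule.span_le.2 hGF
  classical
  obtain ⟨F', hF'I, rfl⟩ := Finset.subset_set_image_iff.1 hFI
  obtain ⟨m, hm, hm0⟩ := Submodule.exists_mem_ne_zero_of_ne_bot hI.1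
  refine ⟨Ideal.span F' ⊔ Ideal.span {m}, ne_bot_of_le_ne_bot (by simpa using hm0)
    (le_sup_right : Ideal.span {m} ≤ _), Submodule.FG.sup (Submodule.fg_span F'.finite_toSet)
    (Submodule.fg_span_singleton m), sup_le (Ideal.span_le.2 hF'I)
    ((Ideal.span_singleton_le_iff_mem _).2 hm), fun P hP hle => ?_⟩
  obtain ⟨N, hN, hPN⟩ := exists_isMaximalTIdeal_le_comap hR (fun P hP => (hΛ P hP).1) hP (hΛ P hP)
  refine IsTPrime.one_notMem_vClosure (IsMaximalTIdeal.isTPrime hN) hL0 ⟨G, hG⟩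
    (hLF.trans (Ideal.span_le.2 ?_)) h1
  rw [Finset.coe_image]
  rintro _ ⟨f, hf, rfl⟩
  exact hPN (hle (Ideal.mem_sup_left (Ideal.subset_span hf)))

end TSharpProperty

end TSharp

theorem proposition2p13 {R K : Type*} [CommRing R] [IsDomain R] [Field K] [Algebra R K]
    [IsFractionRing R K] (hR : TSharp.IsPVMD R K) :
    List.TFAE [
      -- (1)
      ∀ Λ : Set (Ideal R), (∀ P ∈ Λ, TSharp.IsTPrime K P) →
        TSharp.IsVFiniteSystem K (TSharp.tSystem K Λ),
      -- (2)
      TSharp.ACCTPrimes R K ∧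
        ∀ Λ : Set (Ideal R), (∀ P ∈ Λ, TSharp.IsTPrime K P) → IsAntichain (· ≤ ·) Λ →
          TSharp.IsVFiniteSystem K (TSharp.tSystem K Λ),
      -- (3)
      TSharp.ACCRadicalTIdeals R K,
      -- (4)
      TSharp.ACCTPrimes R K ∧
        ∀ I : Ideal R, I ≠ ⊥ → I.FG → (TSharp.vClosure K I).minimalPrimes.Finite,
      -- (5)
      (∀ P : Ideal R, TSharp.IsTPrime K P → TSharp.IsBranched P) ∧
        ∀ T : Subalgebra R K, TSharp.IsTLinked K T → TSharp.IsTSharp T K,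
      -- (6)
      TSharp.ACCTPrimes R K ∧
        ∀ T : Subalgebra R K, TSharp.IsTLinked K T → TSharp.IsTSharp T K] := by
  tfae_have 1 → 3 := TSharp.accRadicalTIdeals_of_isVFiniteSystem
  tfae_have 3 → 4 := fun h =>
    ⟨h.accTPrimes, fun _ h0 _ => h.finite_minimalPrimes (TSharp.isTIdeal_vClosure h0)⟩
  tfae_have 4 → 1 := fun h => TSharp.isVFiniteSystem_of_finite_minimalPrimes hR h.1 h.2
  tfae_have 1 → 2 := fun h => ⟨(tfae_3_to_4 (tfae_1_to_3 h)).1, fun Λ hΛ _ => h Λ hΛ⟩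
  tfae_have 2 → 1 := fun h => TSharp.isVFiniteSystem_of_antichain h.1 h.2
  tfae_have 1 → 6 := fun h =>
    ⟨(tfae_3_to_4 (tfae_1_to_3 h)).1, fun _ => TSharp.isTSharp_of_isVFiniteSystem hR h⟩
  tfae_have 6 → 2 := fun h =>
    ⟨h.1, fun _ hΛ hanti => TSharp.isVFiniteSystem_of_isTSharp hR h.2 hΛ hanti⟩
  tfae_have 5 → 6 := fun h => ⟨TSharp.accTPrimes_of_isBranched hR h.1, h.2⟩
  tfae_have 6 → 5 := fun h => ⟨fun _ => TSharp.ACCTPrimes.isBranched hR h.1, h.2⟩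
  tfae_finish
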